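/- **Definitions.** Let $n\ge 1$. *Signed permutations.* A signed permutation of $[n]=\{1,\dots,n\}$ is a word $\sigma=\sigma_1\cdots\sigma_n$ of nonzero integers such that $|\sigma_1|,\dots,|\sigma_n|$ is a permutation of $1,\dots,n$. For $1\le |k|\le n$: - $\mathcal S_{n,k}$ is the set of signed permutations of $[n]$ with $\sigma_1>\sigma_2<\sigma_3>\sigma_4<\cdots$ and $\sigma_1=k$ (type $B$ alternating permutations; snakes if $k>0$). - $\mathcal A^{(B)}_{n,k}$ is the set of signed permutations $\sigma$ of $[n]$ with $\sigma_n=k$ such that for every $1\le j\le n$ the subword $\sigma_{[j]}$ of the $j$ smallest entries (in their order of appearance in $\sigma$) has no three consecutive letters $a>b>c$ and, if $j\ge2$, ends with an ascent (signed André permutations). *Trees.* An increasing 1-2 tree on a finite set $V$ of integers is a rooted tree with vertex set $V$ in which every vertex has at most two children and is smaller than each of its children. An only child is called a left child; of two siblings the smaller one is the left child and the larger one the right child. The minimal leaf is the end of the path that starts at the root and always passes to the left child until it reaches a leaf. $\mathcal T^{(B)}_{n,k}$ is the set of increasing 1-2 trees with minimal leaf $k$ on the sets $V$ of $n$ nonzero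 integers whose absolute values are $1,\dots,n$ (type $B$ increasing 1-2 trees). *Arnold numbers.* For $1\le|k|\le n$ let $S_{1,1}=S_{1,-1}=1$, $S_{n,-n}=0$ for $n\ge2$, and $$S_{n,k}=\begin{cases}S_{n,k-1}+S_{n-1,-k+1}&\text{if } n\ge k>1,\\ S_{n,-1}&\text{if } n>k=1,\\ S_{n,k-1}+S_{n-1,-k}&\text{if } -1\ge k>-n.\end{cases}$$ A family of sets $(X_{n,k})_{1\le|k|\le n}$ is an Arnold family if $\#X_{n,k}=S_{n,k}$ for all $1\le|k|\le n$. *The map $\psi$.* It sends permutations $\pi$ of $[n]$ with $\pi_1>\pi_2<\pi_3>\cdots$ to increasing 1-2 trees on $[n]$ and is defined recursively. For $n=1,2$ there is one such permutation and one such tree. Let $n\ge3$ and $k=\pi_1$. 1. If $\pi_2=k-1$: delete $k$ and $k-1$ from $\pi$, relabel by $[n-2]$ preserving the order, apply $\psi$, and relabel the resulting tree by $[n]\setminus\{k-1,k\}$ preserving the order. Let $m$ be the smallest vertex greater than $k$ on the minimal path. Insert $k-1$ on the edge from the parent of $m$ to $m$ (as new root if $m$ is the root) and attach $k$ as the left child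 of $k-1$ (so $m$ is its right child). 2. If $\pi_2<k-1$: let $T'=\psi(\pi')$, where $\pi'$ is obtained from $\pi$ by exchanging $k-1$ and $k$. If $k-1$ and $k$ are not siblings in $T'$, then $\psi(\pi)$ is $T'$ with the labels $k-1$ and $k$ exchanged. If they are siblings, with parent $\ell$, and $A$ and $B$ are the (possibly empty) left and right subtrees above $k$, then $\psi(\pi)$ is obtained by replacing the part above $\ell$ as follows: the left child of $\ell$ is $k-1$ and the right subtree of $\ell$ is $A$; the left child of $k-1$ is the leaf $k$ and the right subtree of $k-1$ is $B$. *The map $\omega$.* It sends an increasing 1-2 tree on $[n]$ to the word of its vertices read in reverse inorder (right subtree, vertex, left subtree, recursively). *Relabeling.* For a set $V$ of $n$ integers let $\pi_V:V\to[n]$ be the order-preserving bijection. With $V$ the set of entries of $\sigma$, respectively the set of labels of $T$, put $$\psi^B(\sigma)=\pi_V^{-1}\bigl(\psi(\pi_V(\sigma))\bigr),\qquad \omega^B(T)=\pi_V^{-1}\bigl(\omega(\pi_V(T))\bigr),$$ where maps act on words and trees letter by letter and label by label. **Theorem 2.6.** For all $n$ and $k$ with $1\le|k|\le n$, the maps $\psi^B$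 and $\omega^B$ restrict to bijections $$\psi^B:\mathcal S_{n,k}\to\mathcal T^{(B)}_{n,k},\qquad \omega^B:\mathcal T^{(B)}_{n,k}\to\mathcal A^{(B)}_{n,k}.$$ Consequently, for all $1\le|k|\le n$, $$S_{n,k}=\#\mathcal A^{(B)}_{n,k}=\#\mathcal T^{(B)}_{n,k},$$ that is, $(\mathcal A^{(B)}_{n,k})$ and $(\mathcal T^{(B)}_{n,k})$ are Arnold families. -/

import Mathlib

namespace ArnoldFamily

/-- Root label of a binary tree (`none` for the empty tree). -/
def rootLabel {α : Type*} : BinaryTree α → Option α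
  | .nil => none
  | .node v _ _ => some v

/-- The word of the labels of a binary tree read in inorder:
left subtree, then the vertex, then right subtree. -/
def inorder {α : Type*} : BinaryTree α → List α
  | .nil => []
  | .node v l r => inorder l ++ v :: inorder r

/-- `minLeaf T` is the last vertex of the minimal path of `T`, the path that starts at the root and
goes to the left child as long as there is one (`none` for the empty tree). -/
def minLeaf {α : Type*} : BinaryTree α → Option α
  | .nil => none
  | .node v l _ => some ((minLeaf l).getD v)

/-- Increasing 1-2 trees. Such a tree is a rooted tree without plane structure whose vertices have at
most two children, with distinct labels that increase along edges away from the root. It is stored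
in its unique drawing in which an only child is a left child, and of two siblings the smaller one is
the left child. Thus every vertex is smaller than its children, and the root of a non-empty right
subtree is larger than the root of the (non-empty) left subtree beside it. -/
def IsIncreasing {α : Type*} [LT α] : BinaryTree α → Prop
  | .nil => True
  | .node v l r =>
      (∀ x ∈ rootLabel l, v < x) ∧ (∀ y ∈ rootLabel r, v < y) ∧
      (∀ y ∈ rootLabel r, ∃ x ∈ rootLabel l, x < y) ∧
      IsIncreasing l ∧ IsIncreasing r

/-- A word `w` is (the list of entries of) a signed permutation of `[n]`: the absolute values of its
entries form a permutation of `1, …, n`. -/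
def IsSignedPerm (n : ℕ) (w : List ℤ) : Prop :=
  (w.map Int.natAbs).Perm (List.range' 1 n)

/-- Down-up alternating words: `w₁ > w₂ < w₃ > w₄ < ⋯`. -/
def IsDownUp {α : Type*} [LT α] : List α → Prop
  | a :: b :: c :: w => b < a ∧ b < c ∧ IsDownUp (c :: w)
  | [a, b] => b < a
  | _ => True

/-- The subword of `w` consisting of its `j` smallest entries, in the order in which they appear
(for words with distinct entries). -/
def smallest (w : List ℤ) (j : ℕ) : List ℤ :=
  w.filter fun x => (w.filter fun y => y ≤ x).length ≤ j

/-- No three consecutive letters `a > b > c`. -/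
def NoDoubleDescent (w : List ℤ) : Prop :=
  ∀ a b c : ℤ, [a, b, c] <:+: w → ¬ (b < a ∧ c < b)

/-- The last two letters form an ascent (no condition on words with fewer than two letters). -/
def EndsWithAscent (w : List ℤ) : Prop :=
  ∀ a b : ℤ, [a, b] <:+ w → a < b

/-- Type B alternating permutations of `[n]` with first entry `k` (for `k > 0`: the snakes). -/
def snakesB (n : ℕ) (k : ℤ) : Set (List ℤ) :=
  {w | IsSignedPerm n w ∧ IsDownUp w ∧ w.head? = some k}

/-- Type B increasing 1-2 trees on `[n]` with minimal leaf `k`. -/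
def treesB (n : ℕ) (k : ℤ) : Set (BinaryTree ℤ) :=
  {T | IsIncreasing T ∧ IsSignedPerm n (inorder T) ∧ minLeaf T = some k}

/-- Signed André permutations of `[n]` with last entry `k`. -/
def andreB (n : ℕ) (k : ℤ) : Set (List ℤ) :=
  {w | IsSignedPerm n w ∧
    (∀ j, 1 ≤ j → j ≤ n → NoDoubleDescent (smallest w j) ∧ EndsWithAscent (smallest w j)) ∧
    w.getLast? = some k}

/-- The Arnold numbers `S_{n,k}`, `1 ≤ |k| ≤ n` (and `0` outside of this range). -/
def arnold (n : ℕ) (k : ℤ) : ℕ :=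
  if k = 0 ∨ (n : ℤ) < |k| then 0
  else if n = 1 then 1
  else if k = -(n : ℤ) then 0
  else if k < 0 then arnold n (k - 1) + arnold (n - 1) (-k)
  else if k = 1 then arnold n (-1)
  else arnold n (k - 1) + arnold (n - 1) (-k + 1)
termination_by (n, (k + n).toNat)
decreasing_by
  all_goals
    simp only [not_or, not_lt, abs_le] at *
    first
      | exact Prod.Lex.left _ _ (by omega)
      | exact Prod.Lex.right _ (by omega)

/-- `(X_{n,k})` is an Arnold family if `X_{n,k}` has exactly `S_{n,k}` elements
for `1 ≤ |k| ≤ n`. -/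
def IsArnoldFamily {α : Type*} (X : ℕ → ℤ → Set α) : Prop :=
  ∀ (n : ℕ) (k : ℤ), 1 ≤ |k| → |k| ≤ (n : ℤ) → (X n k).encard = arnold n k

/-- Let `m` be the smallest vertex greater than `k` on the minimal path of `T`. Put a new
vertex `k - 1` on the edge from the parent of `m` to `m` (above the root if `m` is the root),
with left child a new leaf `k` and right child `m`. -/
def graft (k : ℕ) : BinaryTree ℕ → BinaryTree ℕ
  | .nil => .nil
  | .node v l r =>
      if k < v then .node (k - 1) (.node k .nil .nil) (.node v l r)
      else .node v (graft k l) r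

/-- Some vertex of the tree has left child `a` and right child `b`. -/
def areSiblings (a b : ℕ) : BinaryTree ℕ → Bool
  | .nil => false
  | .node _ l r =>
      (rootLabel l == some a && rootLabel r == some b) || areSiblings a b l || areSiblings a b r

/-- At the vertex `v` of the minimal path whose left child is the leaf `k - 1` and whose right child
is `k`, with left and right subtrees `A` and `B` above `k`: make `A` the right subtree of `v`, and
give its left child `k - 1` the leaf `k` as left child and `B` as right subtree. -/
def rotate (k : ℕ) : BinaryTree ℕ → BinaryTree ℕ
  | .nil => .nil
  | .node v l r =>
      if rootLabel l = some (k - 1) ∧ rootLabel r = some k then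
        .node v (.node (k - 1) (.node k .nil .nil) r.right) r.left
      else .node v (rotate k l) r

/-- The bijection `ψ` of Gelineau, Shin and Zeng from down-up alternating permutations of `[n]` to
increasing 1-2 trees on `[n]`, for a permutation with first entries `k, j`.
If `j = k - 1`: remove `k` and `k - 1`, standardize, apply `ψ`, make room for the labels `k - 1` and
`k`, and graft these. If `j < k - 1`: exchange `k - 1` and `k`, apply `ψ`, and then rotate if
`k - 1` and `k` are siblings, and exchange the labels `k - 1` and `k` otherwise.
(Words that are not down-up get irrelevant values.) -/
def psi : List ℕ → BinaryTree ℕ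
  | [] => .nil
  | [a] => .node a .nil .nil
  | [a, b] => .node b (.node a .nil .nil) .nil
  | k :: j :: c :: w =>
      if j + 1 = k then
        graft k ((psi ((c :: w).map fun x => if k < x then x - 2 else x)).map
          fun x => if x + 1 < k then x else x + 2)
      else if j + 1 < k then
        let T := psi ((k :: j :: c :: w).map (Equiv.swap (k - 1) k))
        if areSiblings (k - 1) k T then rotate k T else T.map (Equiv.swap (k - 1) k)
      else .nil
termination_by w => (w.length, w.headD 0)
decreasing_by
  all_goals simp [Prod.lex_def]
  all_goals omega

/-- The map `ω`: read the vertices of the tree in reverse inorder. -/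
def omega (T : BinaryTree ℕ) : List ℕ := (inorder T).reverse

/-- The order-preserving map `V → {1, …, |V|}`, sending the `i`-th smallest element to `i`. -/
def rank (V : Finset ℤ) (x : ℤ) : ℕ := (V.filter (· ≤ x)).card

/-- The inverse of `rank V`: the `i`-th smallest element of `V`, for `1 ≤ i ≤ |V|`. -/
def unrank (V : Finset ℤ) (i : ℕ) : ℤ := (V.sort (· ≤ ·)).getD (i - 1) 0

/-- `ψ^B(σ) = π⁻¹(ψ(π σ))`, where `π` is the order-preserving map from the entries of `σ`
to `[n]`. -/
def psiB (w : List ℤ) : BinaryTree ℤ :=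
  (psi (w.map (rank w.toFinset))).map (unrank w.toFinset)

/-- `ω^B(T) = π⁻¹(ω(π T))`, where `π` is the order-preserving map from the labels of `T`
to `[n]`. -/
def omegaB (T : BinaryTree ℤ) : List ℤ :=
  (omega (T.map (rank (inorder T).toFinset))).map (unrank (inorder T).toFinset)

end ArnoldFamily

open ArnoldFamily

/-!
`ω` reads a tree in reverse inorder, so `ω^B` needs no relabeling: the smallest entry of a word is
the root, the letters after it form the left subtree and those before it the right subtree, and
every word meeting the André conditions arises exactly once.

For `ψ`, both sides satisfy the same recurrence. Down-up permutations that start with `k, k - 1`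
correspond to shorter ones by deleting these two letters; all others with first entry `k` correspond
to those with first entry `k - 1` by exchanging the two values. Among the trees with minimal leaf
`k`, those that stay increasing when `k` is removed and `k - 1` is replaced by its right subtree
(which must not be empty) are the grafts of smaller trees. The other ones come from the trees with
minimal leaf `k - 1`: by the rotation if `k` is the left child of `k - 1`, and by exchanging the two
labels if it is not. Fixing the set of entries, `ψ^B` is conjugate to `ψ`.

The Arnold numbers count snakes. Let `j` be the predecessor of `k` among the nonzero integers.
Snakes that start with `k` but not with `k, j` correspond to snakes that start with `j`, by
exchanging `±k` and `±j`. In those that start with `k, j`, deleting `k`, closing the gap at `±k` and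
negating leaves a snake of length `n - 1`.
-/

namespace ArnoldFamily

section Sets

variable {α β γ : Type*} {f : α → β} {s : Set α} {t : Set β}

theorem bijOn_of_fibers {p : α → γ} {q : β → γ}
    (h : ∀ c, Set.BijOn f {x ∈ s | p x = c} {y ∈ t | q y = c}) : Set.BijOn f s t := by
  have hq : ∀ {x}, x ∈ s → f x ∈ t ∧ q (f x) = p x := fun hx => (h _).mapsTo ⟨hx, rfl⟩
  refine ⟨fun x hx => (hq hx).1, fun x hx y hy hxy => ?_, fun y hy => ?_⟩
  · exact (h (p y)).injOn ⟨hx, by rw [← (hq hx).2, hxy, (hq hy).2]⟩ ⟨hy, rfl⟩ hxy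
  · obtain ⟨x, hx, hxy⟩ := (h (q y)).surjOn ⟨hy, rfl⟩
    exact ⟨x, hx.1, hxy⟩

theorem bijOn_of_sep {p : α → Prop} {q : β → Prop}
    (h : Set.BijOn f {x ∈ s | p x} {y ∈ t | q y})
    (h' : Set.BijOn f {x ∈ s | ¬ p x} {y ∈ t | ¬ q y}) : Set.BijOn f s t :=
  bijOn_of_fibers (p := p) (q := q) fun c => by
    by_cases hc : c
    · simpa only [eq_iff_iff, hc, iff_true] using h
    · simpa only [eq_iff_iff, hc, iff_false] using h'

theorem encard_eq_of_bijOn (h : Set.BijOn f s t) : s.encard = t.encard := by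
  rw [← h.image_eq, h.injOn.encard_image]

end Sets

section Trees

variable {α β : Type*}

theorem inorder_map (f : α → β) (T : BinaryTree α) :
    inorder (T.map f) = (inorder T).map f := by
  induction T with
  | nil => rfl
  | node v l r hl hr => simp [inorder, BinaryTree.map, hl, hr]

theorem rootLabel_map (f : α → β) (T : BinaryTree α) :
    rootLabel (T.map f) = (rootLabel T).map f := by
  cases T <;> rfl

theorem minLeaf_map (f : α → β) (T : BinaryTree α) :
    minLeaf (T.map f) = (minLeaf T).map f := by
  induction T with
  | nil => rfl
  | node v l r hl _ => cases h : minLeaf l <;> simp [minLeaf, BinaryTree.map, hl, h]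

theorem head?_inorder (T : BinaryTree α) : (inorder T).head? = minLeaf T := by
  induction T with
  | nil => rfl
  | node v l r hl _ =>
    simp only [inorder, List.head?_append, hl, minLeaf]
    cases minLeaf l <;> rfl

theorem mem_inorder_of_minLeaf {T : BinaryTree α} {x : α} (h : minLeaf T = some x) :
    x ∈ inorder T :=
  List.mem_of_head? ((head?_inorder T).trans h)

theorem mem_inorder_of_rootLabel {T : BinaryTree α} {x : α} (h : rootLabel T = some x) :
    x ∈ inorder T := by
  cases T <;> simp_all [rootLabel, inorder]

theorem rootLabel_eq_none {T : BinaryTree α} : rootLabel T = none ↔ T = .nil := by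
  cases T <;> simp [rootLabel]

theorem map_congr {f g : α → β} {T : BinaryTree α} (h : ∀ x ∈ inorder T, f x = g x) :
    T.map f = T.map g := by
  induction T with
  | nil => rfl
  | node v l r hl hr =>
    simp only [inorder, List.mem_append, List.mem_cons] at h
    simp only [BinaryTree.map]
    rw [h v (by simp), hl fun x hx => h x (by simp [hx]), hr fun x hx => h x (by simp [hx])]

theorem map_map_eq_self {f : α → β} {g : β → α} {T : BinaryTree α}
    (h : ∀ x ∈ inorder T, g (f x) = x) : (T.map f).map g = T := by
  rw [← BinaryTree.comp_map]
  exact (map_congr (g := id) h).trans T.id_map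

theorem list_map_map_eq_self {f : α → β} {g : β → α} {w : List α}
    (h : ∀ x ∈ w, g (f x) = x) : (w.map f).map g = w := by
  rw [List.map_map]
  exact (List.map_congr_left h).trans (List.map_id w)

theorem map_injective {f : α → β} (hf : Function.Injective f) :
    Function.Injective (BinaryTree.map f) := by
  intro T T' h
  induction T generalizing T' with
  | nil => cases T' <;> simp_all [BinaryTree.map]
  | node v l r hl hr =>
    cases T' with
    | nil => simp [BinaryTree.map] at h
    | node v' l' r' =>
      simp only [BinaryTree.map, BinaryTree.node.injEq] at h
      rw [hf h.1, hl h.2.1, hr h.2.2]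

theorem exists_map_eq {f : α → β} {T : BinaryTree β} (h : ∀ x ∈ inorder T, x ∈ Set.range f) :
    ∃ T' : BinaryTree α, T'.map f = T := by
  induction T with
  | nil => exact ⟨.nil, rfl⟩
  | node v l r hl hr =>
    simp only [inorder, List.mem_append, List.mem_cons] at h
    obtain ⟨v', hv⟩ := h v (by simp)
    obtain ⟨l', hl⟩ := hl fun x hx => h x (by simp [hx])
    obtain ⟨r', hr⟩ := hr fun x hx => h x (by simp [hx])
    exact ⟨.node v' l' r', by simp only [BinaryTree.map, hv, hl, hr]⟩

end Trees

section Increasing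

variable {α β : Type*}

theorem IsIncreasing.rootLabel_le [Preorder α] {T : BinaryTree α} (hT : IsIncreasing T) {a : α}
    (ha : rootLabel T = some a) {x : α} (hx : x ∈ inorder T) : a ≤ x := by
  induction T generalizing a with
  | nil => simp [inorder] at hx
  | node v l r hl hr =>
    obtain ⟨h1, h2, -, h4, h5⟩ := hT
    obtain rfl : v = a := by simpa only [rootLabel, Option.some.injEq] using ha
    simp only [inorder, List.mem_append, List.mem_cons] at hx
    rcases hx with hx | rfl | hx
    · cases h : rootLabel l with
      | none => simp [rootLabel_eq_none.1 h, inorder] at hx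
      | some y => exact (h1 y h).le.trans (hl h4 h hx)
    · exact le_rfl
    · cases h : rootLabel r with
      | none => simp [rootLabel_eq_none.1 h, inorder] at hx
      | some y => exact (h2 y h).le.trans (hr h5 h hx)

theorem IsIncreasing.exists_rootLabel_le [Preorder α] {T : BinaryTree α} (hT : IsIncreasing T)
    {x : α} (hx : x ∈ inorder T) : ∃ y ∈ rootLabel T, y ≤ x := by
  cases h : rootLabel T with
  | none => simp [rootLabel_eq_none.1 h, inorder] at hx
  | some y => exact ⟨y, rfl, hT.rootLabel_le h hx⟩

theorem isIncreasing_node_iff [Preorder α] {v : α} {l r : BinaryTree α} :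
    IsIncreasing (.node v l r) ↔
      (∀ x ∈ inorder l, v < x) ∧ (∀ y ∈ inorder r, v < y) ∧
      (∀ y ∈ inorder r, ∃ x ∈ inorder l, x < y) ∧ IsIncreasing l ∧ IsIncreasing r := by
  constructor
  · rintro ⟨hl, hr, hlr, il, ir⟩
    refine ⟨fun x hx => ?_, fun y hy => ?_, fun y hy => ?_, il, ir⟩
    · obtain ⟨x', hx', hle⟩ := il.exists_rootLabel_le hx
      exact (hl x' hx').trans_le hle
    · obtain ⟨y', hy', hle⟩ := ir.exists_rootLabel_le hy
      exact (hr y' hy').trans_le hle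
    · obtain ⟨y', hy', hle⟩ := ir.exists_rootLabel_le hy
      obtain ⟨x, hx, hxy⟩ := hlr y' hy'
      exact ⟨x, mem_inorder_of_rootLabel hx, hxy.trans_le hle⟩
  · rintro ⟨hl, hr, hlr, il, ir⟩
    refine ⟨fun x hx => hl x (mem_inorder_of_rootLabel hx),
      fun y hy => hr y (mem_inorder_of_rootLabel hy), fun y hy => ?_, il, ir⟩
    obtain ⟨x, hx, hxy⟩ := hlr y (mem_inorder_of_rootLabel hy)
    obtain ⟨x', hx', hle⟩ := il.exists_rootLabel_le hx
    exact ⟨x', hx', hle.trans_lt hxy⟩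

theorem isIncreasing_map_iff [LinearOrder α] [Preorder β] {f : α → β} {T : BinaryTree α}
    (hf : StrictMonoOn f {x | x ∈ inorder T}) : IsIncreasing (T.map f) ↔ IsIncreasing T := by
  induction T with
  | nil => rfl
  | node v l r hl hr =>
    have hv : v ∈ inorder (.node v l r) := by simp [inorder]
    have hsl : {x | x ∈ inorder l} ⊆ {x | x ∈ inorder (.node v l r)} := fun x hx => by
      simp_all [inorder]
    have hsr : {x | x ∈ inorder r} ⊆ {x | x ∈ inorder (.node v l r)} := fun x hx => by
      simp_all [inorder]
    simp only [BinaryTree.map, isIncreasing_node_iff, inorder_map, List.mem_map,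
      forall_exists_index, and_imp, forall_apply_eq_imp_iff₂, exists_exists_and_eq_and,
      hl (hf.mono hsl), hr (hf.mono hsr)]
    refine and_congr (forall₂_congr fun x hx => hf.lt_iff_lt hv (hsl hx)) <|
      and_congr (forall₂_congr fun y hy => hf.lt_iff_lt hv (hsr hy)) <|
      and_congr_left fun _ => forall₂_congr fun y hy => exists_congr fun x =>
        and_congr_right fun hx => hf.lt_iff_lt (hsl hx) (hsr hy)

theorem IsIncreasing.eq_of_inorder_eq [PartialOrder α] {T T' : BinaryTree α}
    (hT : IsIncreasing T) (hT' : IsIncreasing T') (hn : (inorder T).Nodup)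
    (h : inorder T = inorder T') : T = T' := by
  induction T generalizing T' with
  | nil => cases T' <;> simp_all [inorder]
  | node v l r hl hr =>
    cases T' with
    | nil => simp [inorder] at h
    | node v' l' r' =>
      obtain rfl : v = v' := le_antisymm
        (hT.rootLabel_le rfl (by rw [h]; simp [inorder]))
        (hT'.rootLabel_le rfl (by rw [← h]; simp [inorder]))
      rw [isIncreasing_node_iff] at hT hT'
      have hvl : v ∉ inorder l := fun hv => (hT.1 v hv).false
      have hvr : v ∉ inorder r := fun hv => (hT.2.1 v hv).false
      have hvl' : v ∉ inorder l' := fun hv => (hT'.1 v hv).false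
      have hvr' : v ∉ inorder r' := fun hv => (hT'.2.1 v hv).false
      simp only [inorder] at h hn
      obtain ⟨e1, e2⟩ : inorder l = inorder l' ∧ inorder r = inorder r' := by
        rcases List.append_eq_append_iff.1 h with ⟨s, hs1, hs2⟩ | ⟨s, hs1, hs2⟩ <;>
          cases s <;> simp_all
      rw [List.nodup_append, List.nodup_cons] at hn
      rw [hl hT.2.2.2.1 hT'.2.2.2.1 hn.1 e1, hr hT.2.2.2.2 hT'.2.2.2.2 hn.2.1.2 e2]

theorem isDownUp_map_iff [LinearOrder α] [Preorder β] {f : α → β} {w : List α}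
    (hf : StrictMonoOn f {x | x ∈ w}) : IsDownUp (w.map f) ↔ IsDownUp w := by
  fun_induction IsDownUp w with
  | case1 a b c w ih =>
    simp only [List.map_cons, IsDownUp] at ih ⊢
    rw [hf.lt_iff_lt (by simp) (by simp), hf.lt_iff_lt (by simp) (by simp),
      ih (hf.mono fun x hx => by simp_all)]
  | case2 a b => exact hf.lt_iff_lt (by simp) (by simp)
  | case3 w h1 h2 =>
    match w with
    | [] => simp [IsDownUp]
    | [a] => simp [IsDownUp]
    | [a, b] => exact (h2 a b rfl).elim
    | a :: b :: c :: w => exact (h1 a b c w rfl).elim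

theorem IsDownUp.map_cons [LinearOrder α] [Preorder β] {f : α → β} {x y : α} {w : List α}
    (h : IsDownUp (x :: y :: w)) (hf : StrictMonoOn f {z | z ∈ y :: w}) (hyx : f y < f x) :
    IsDownUp ((x :: y :: w).map f) := by
  match w, h with
  | [], _ => exact hyx
  | z :: w, ⟨_, hyz, hw⟩ =>
    exact ⟨hyx, hf (by simp) (by simp) hyz,
      (isDownUp_map_iff (hf.mono fun a ha => List.mem_cons_of_mem _ ha)).2 hw⟩

end Increasing

section Andre

/-- The André condition on a word: the condition on its `j` smallest entries for every `j`, with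
these entries selected by a threshold. -/
def IsAndre (w : List ℤ) : Prop :=
  ∀ t : ℤ, NoDoubleDescent (w.filter (· ≤ t)) ∧ EndsWithAscent (w.filter (· ≤ t))

theorem noDoubleDescent_nil : NoDoubleDescent [] := fun a b c h => by simp at h

theorem endsWithAscent_nil : EndsWithAscent [] := fun a b h => by simp at h

theorem isAndre_nil : IsAndre [] := fun _ => ⟨noDoubleDescent_nil, endsWithAscent_nil⟩

theorem filter_le_sublist (w : List ℤ) {s t : ℤ} (h : s ≤ t) :
    (w.filter (· ≤ s)).Sublist (w.filter (· ≤ t)) :=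
  List.monotone_filter_right w fun x hx => by
    simp only [decide_eq_true_eq] at hx ⊢
    exact hx.trans h

theorem length_filter_le_le_iff {w : List ℤ} {t x : ℤ} (hx : x ∈ w) :
    (w.filter (· ≤ x)).length ≤ (w.filter (· ≤ t)).length ↔ x ≤ t := by
  refine ⟨fun h => ?_, fun h => (filter_le_sublist w h).length_le⟩
  by_contra! hlt
  have heq := (filter_le_sublist w hlt.le).eq_of_length_le h
  have hmem : x ∈ w.filter (· ≤ t) := heq ▸ List.mem_filter.2 ⟨hx, by simp⟩
  simp only [List.mem_filter, decide_eq_true_eq] at hmem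
  exact hlt.not_ge hmem.2

theorem smallest_length_filter_le (w : List ℤ) (t : ℤ) :
    smallest w (w.filter (· ≤ t)).length = w.filter (· ≤ t) :=
  List.filter_congr fun x hx => by simp only [length_filter_le_le_iff hx]

theorem exists_smallest_eq_filter_le {w : List ℤ} {j : ℕ} (h : smallest w j ≠ []) :
    ∃ t, smallest w j = w.filter (· ≤ t) := by
  obtain ⟨t, ht, htmax⟩ := (smallest w j).toFinset.exists_max_image id
    (by simpa [List.toFinset_nonempty_iff] using h)
  simp only [smallest, List.mem_toFinset, List.mem_filter, decide_eq_true_eq, id] at ht htmax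
  refine ⟨t, List.filter_congr fun x hx => ?_⟩
  simp only [decide_eq_decide]
  exact ⟨fun hj => htmax x ⟨hx, hj⟩, fun h => ((length_filter_le_le_iff hx).2 h).trans ht.2⟩

theorem isAndre_iff_smallest (w : List ℤ) : IsAndre w ↔ ∀ j, 1 ≤ j → j ≤ w.length →
    NoDoubleDescent (smallest w j) ∧ EndsWithAscent (smallest w j) := by
  constructor
  · intro h j _ _
    by_cases h0 : smallest w j = []
    · rw [h0]; exact ⟨noDoubleDescent_nil, endsWithAscent_nil⟩
    · obtain ⟨t, ht⟩ := exists_smallest_eq_filter_le h0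
      rw [ht]; exact h t
  · intro h t
    by_cases h0 : w.filter (· ≤ t) = []
    · rw [h0]; exact ⟨noDoubleDescent_nil, endsWithAscent_nil⟩
    · rw [← smallest_length_filter_le]
      exact h _ (List.length_pos_iff.2 h0) (List.length_filter_le _ _)

theorem NoDoubleDescent.infix {u w : List ℤ} (hw : NoDoubleDescent w) (h : u <:+: w) :
    NoDoubleDescent u :=
  fun a b c h' => hw a b c (h'.trans h)

theorem noDoubleDescent_append_cons_iff {u v : List ℤ} {m : ℤ} (hu : ∀ x ∈ u, m < x)
    (hv : ∀ x ∈ v, m < x) (hn : u.Nodup) :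
    NoDoubleDescent (u ++ m :: v) ↔ NoDoubleDescent u ∧ EndsWithAscent u ∧ NoDoubleDescent v := by
  constructor
  · intro h
    refine ⟨h.infix (List.prefix_append _ _).isInfix, fun a b hab => ?_,
      h.infix ((List.suffix_cons m v).trans (List.suffix_append _ _)).isInfix⟩
    have hne : a ≠ b := by simpa using hn.sublist hab.sublist
    have hbm : m < b := hu b (hab.subset (by simp))
    obtain ⟨s, rfl⟩ := hab
    have := h a b m ⟨s, v, by simp⟩
    omega
  · rintro ⟨hu1, hu2, hv1⟩ a b c habc ⟨hba, hcb⟩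
    rcases List.infix_append_iff.1 habc with h | h | ⟨t₁, t₂, ht, h₁, h₂⟩
    · exact hu1 a b c h ⟨hba, hcb⟩
    · rcases List.infix_cons_iff.1 h with h | h
      · obtain ⟨rfl, h'⟩ := List.cons_prefix_cons.1 h
        exact (hv b (h'.subset (by simp))).not_gt hba
      · exact hv1 a b c h ⟨hba, hcb⟩
    · match t₁, ht with
      | [], ht =>
        obtain rfl : [a, b, c] = t₂ := ht
        obtain ⟨rfl, h⟩ := List.cons_prefix_cons.1 h₂
        exact (hv b (h.subset (by simp))).not_gt hba
      | [_], ht =>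
        obtain ⟨rfl, rfl⟩ : a = _ ∧ [b, c] = t₂ := by simpa using ht
        obtain ⟨rfl, h⟩ := List.cons_prefix_cons.1 h₂
        exact (hv c (h.subset (by simp))).not_gt hcb
      | [_, _], ht =>
        obtain ⟨rfl, rfl, -⟩ : a = _ ∧ b = _ ∧ [c] = t₂ := by simpa using ht
        exact (hu2 a b h₁).not_gt hba
      | _ :: _ :: _ :: t, ht =>
        obtain ⟨rfl, rfl, rfl, rfl, -⟩ : a = _ ∧ b = _ ∧ c = _ ∧ t = [] ∧ t₂ = [] := by
          simpa [eq_comm] using ht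
        exact hu1 a b c h₁.isInfix ⟨hba, hcb⟩

theorem endsWithAscent_append_cons_iff {u v : List ℤ} {m : ℤ} (hu : ∀ x ∈ u, m < x)
    (hv : ∀ x ∈ v, m < x) :
    EndsWithAscent (u ++ m :: v) ↔ EndsWithAscent v ∧ (v = [] → u = []) := by
  match v with
  | [] =>
    refine ⟨fun h => ⟨endsWithAscent_nil, fun _ => ?_⟩, ?_⟩
    · by_contra hne
      obtain ⟨s, z, rfl⟩ := (List.eq_nil_or_concat u).resolve_left hne
      exact (h z m ⟨s, by simp⟩).not_gt (hu z (by simp))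
    · rintro ⟨-, h0⟩ a b hab
      simpa [h0 rfl] using hab.length_le
  | [c] =>
    refine ⟨fun _ => ⟨fun a b hab => by simpa using hab.length_le, by simp⟩, fun _ a b hab => ?_⟩
    have h : [m, c] <:+ u ++ [m, c] := List.suffix_append _ _
    obtain ⟨rfl, rfl⟩ : a = m ∧ b = c := by
      simpa using (List.suffix_of_suffix_length_le hab h (by simp)).eq_of_length (by simp)
    exact hv b (by simp)
  | c :: d :: v =>
    have h : c :: d :: v <:+ u ++ m :: c :: d :: v :=
      (List.suffix_cons m _).trans (List.suffix_append _ _)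
    exact ⟨fun hw => ⟨fun a b hab => hw a b (hab.trans h), by simp⟩, fun hw a b hab =>
      hw.1 a b (List.suffix_of_suffix_length_le hab h (by simp))⟩

theorem isAndre_iff_of_forall_le {w : List ℤ} {m : ℤ} (hm : ∀ x ∈ w, m ≤ x) :
    IsAndre w ↔
      ∀ t, m ≤ t → NoDoubleDescent (w.filter (· ≤ t)) ∧ EndsWithAscent (w.filter (· ≤ t)) := by
  refine ⟨fun h t _ => h t, fun h t => ?_⟩
  by_cases ht : m ≤ t
  · exact h t ht
  · have h0 : w.filter (· ≤ t) = [] := by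
      simp only [List.filter_eq_nil_iff, decide_eq_true_eq]
      exact fun x hx hxt => ht ((hm x hx).trans hxt)
    rw [h0]; exact ⟨noDoubleDescent_nil, endsWithAscent_nil⟩

theorem isAndre_append_cons_iff {u v : List ℤ} {m : ℤ} (hu : ∀ x ∈ u, m < x)
    (hv : ∀ x ∈ v, m < x) (hn : u.Nodup) :
    IsAndre (u ++ m :: v) ↔ IsAndre u ∧ IsAndre v ∧ ∀ y ∈ u, ∃ x ∈ v, x ≤ y := by
  have hfilter : ∀ t, m ≤ t →
      (u ++ m :: v).filter (· ≤ t) = u.filter (· ≤ t) ++ m :: v.filter (· ≤ t) := fun t ht => by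
    rw [List.filter_append, List.filter_cons_of_pos (by simpa using ht)]
  have hu' : ∀ t, ∀ x ∈ u.filter (· ≤ t), m < x := fun t x hx => hu x (List.mem_filter.1 hx).1
  have hv' : ∀ t, ∀ x ∈ v.filter (· ≤ t), m < x := fun t x hx => hv x (List.mem_filter.1 hx).1
  have hm : ∀ x ∈ u ++ m :: v, m ≤ x := by
    simp only [List.mem_append, List.mem_cons]
    rintro x (hx | rfl | hx)
    exacts [(hu x hx).le, le_rfl, (hv x hx).le]
  have hsplit : IsAndre (u ++ m :: v) ↔ ∀ t, m ≤ t →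
      (NoDoubleDescent (u.filter (· ≤ t)) ∧ EndsWithAscent (u.filter (· ≤ t)) ∧
        NoDoubleDescent (v.filter (· ≤ t))) ∧
      EndsWithAscent (v.filter (· ≤ t)) ∧ (v.filter (· ≤ t) = [] → u.filter (· ≤ t) = []) := by
    rw [isAndre_iff_of_forall_le hm]
    refine forall₂_congr fun t ht => ?_
    rw [hfilter t ht, noDoubleDescent_append_cons_iff (hu' t) (hv' t) (hn.filter _),
      endsWithAscent_append_cons_iff (hu' t) (hv' t)]
  rw [hsplit, isAndre_iff_of_forall_le fun x hx => (hu x hx).le,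
    isAndre_iff_of_forall_le fun x hx => (hv x hx).le]
  constructor
  · intro h
    refine ⟨fun t ht => ⟨(h t ht).1.1, (h t ht).1.2.1⟩, fun t ht => ⟨(h t ht).1.2.2, (h t ht).2.1⟩,
      fun y hy => ?_⟩
    by_contra! hlt
    have hnil := (h y (hu y hy).le).2.2 (by simpa using hlt)
    simpa using List.filter_eq_nil_iff.1 hnil y hy
  · rintro ⟨hAu, hAv, huv⟩ t ht
    refine ⟨⟨(hAu t ht).1, (hAu t ht).2, (hAv t ht).1⟩, (hAv t ht).2, fun h0 => ?_⟩
    simp only [List.filter_eq_nil_iff, decide_eq_true_eq] at h0 ⊢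
    intro y hy hyt
    obtain ⟨x, hx, hxy⟩ := huv y hy
    exact h0 x hx (hxy.trans hyt)

theorem reverse_inorder_node {α : Type*} (v : α) (l r : BinaryTree α) :
    (inorder (.node v l r)).reverse = (inorder r).reverse ++ v :: (inorder l).reverse := by
  simp [inorder]

theorem IsIncreasing.isAndre {T : BinaryTree ℤ} (hT : IsIncreasing T) (hn : (inorder T).Nodup) :
    IsAndre (inorder T).reverse := by
  induction T with
  | nil => exact isAndre_nil
  | node v l r hl hr =>
    obtain ⟨hvl, hvr, hlr, il, ir⟩ := isIncreasing_node_iff.1 hT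
    simp only [inorder, List.nodup_append, List.nodup_cons] at hn
    rw [reverse_inorder_node, isAndre_append_cons_iff (by simpa using hvr) (by simpa using hvl)
      (by simpa using hn.2.1.2)]
    refine ⟨hr ir hn.2.1.2, hl il hn.1, fun y hy => ?_⟩
    obtain ⟨x, hx, hxy⟩ := hlr y (List.mem_reverse.1 hy)
    exact ⟨x, List.mem_reverse.2 hx, hxy.le⟩

theorem exists_eq_append_min_cons {w : List ℤ} (hn : w.Nodup) (h0 : w ≠ []) :
    ∃ u m v, w = u ++ m :: v ∧ (∀ x ∈ u, m < x) ∧ ∀ x ∈ v, m < x := by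
  obtain ⟨m, hm, hmin⟩ := w.toFinset.exists_min_image id
    (by simpa [List.toFinset_nonempty_iff] using h0)
  simp only [List.mem_toFinset, id] at hm hmin
  obtain ⟨u, v, rfl⟩ := List.append_of_mem hm
  rw [List.nodup_append, List.nodup_cons] at hn
  exact ⟨u, m, v, rfl,
    fun x hx => (hmin x (by simp [hx])).lt_of_ne (hn.2.2 x hx m (by simp)).symm,
    fun x hx => (hmin x (by simp [hx])).lt_of_ne fun h => hn.2.1.1 (h ▸ hx)⟩

theorem IsAndre.exists_tree {w : List ℤ} (hw : IsAndre w) (hn : w.Nodup) :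
    ∃ T : BinaryTree ℤ, IsIncreasing T ∧ (inorder T).reverse = w := by
  induction hlen : w.length using Nat.strong_induction_on generalizing w with
  | _ n ih =>
  by_cases h0 : w = []
  · exact ⟨.nil, trivial, by simp [h0, inorder]⟩
  obtain ⟨u, m, v, rfl, hu, hv⟩ := exists_eq_append_min_cons hn h0
  rw [List.nodup_append, List.nodup_cons] at hn
  obtain ⟨hnu, ⟨-, hnv⟩, hdisj⟩ := hn
  obtain ⟨hAu, hAv, huv⟩ := (isAndre_append_cons_iff hu hv hnu).1 hw
  simp only [List.length_append, List.length_cons] at hlen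
  obtain ⟨R, hR, rfl⟩ := ih _ (by omega) hAu hnu rfl
  obtain ⟨L, hL, rfl⟩ := ih _ (by omega) hAv hnv rfl
  simp only [List.mem_reverse, List.mem_cons] at hu hv huv hdisj
  refine ⟨.node m L R, isIncreasing_node_iff.2 ⟨hv, hu, fun y hy => ?_, hL, hR⟩,
    reverse_inorder_node m L R⟩
  obtain ⟨x, hx, hxy⟩ := huv y hy
  exact ⟨x, hx, hxy.lt_of_ne (hdisj y hy x (.inr hx)).symm⟩

end Andre

section LeftSpine

variable {α β : Type*}

/-- The one-vertex tree. -/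
abbrev leaf (a : α) : BinaryTree α := .node a .nil .nil

/-- The tree obtained by putting `S` at the lower end of a left spine, given as the list of its
vertices from the root downwards, each with its right subtree. Every position on the minimal path
of a tree is described in this way. -/
def plug (c : List (α × BinaryTree α)) (S : BinaryTree α) : BinaryTree α :=
  c.foldr (fun p T => .node p.1 T p.2) S

theorem plug_cons (p : α × BinaryTree α) (c : List (α × BinaryTree α)) (S : BinaryTree α) :
    plug (p :: c) S = .node p.1 (plug c S) p.2 :=
  rfl

theorem plug_append (c d : List (α × BinaryTree α)) (S : BinaryTree α) :
    plug (c ++ d) S = plug c (plug d S) :=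
  List.foldr_append

theorem map_plug (f : α → β) (c : List (α × BinaryTree α)) (S : BinaryTree α) :
    (plug c S).map f = plug (c.map fun p => (f p.1, p.2.map f)) (S.map f) := by
  induction c with
  | nil => rfl
  | cons p c ih => simp only [plug_cons, BinaryTree.map, ih, List.map_cons]

theorem inorder_plug (c : List (α × BinaryTree α)) (S : BinaryTree α) :
    inorder (plug c S) = inorder S ++ inorder (plug c .nil) := by
  induction c with
  | nil => simp [plug, inorder]
  | cons p c ih => simp only [plug_cons, inorder, ih, List.append_assoc]

theorem nodup_of_plug {c : List (α × BinaryTree α)} {S : BinaryTree α}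
    (hn : (inorder (plug c S)).Nodup) : (inorder S).Nodup := by
  rw [inorder_plug] at hn
  exact (List.nodup_append.1 hn).1

theorem perm_inorder_plug {S S' : BinaryTree α} (h : (inorder S).Perm (inorder S'))
    (c : List (α × BinaryTree α)) : (inorder (plug c S)).Perm (inorder (plug c S')) := by
  rw [inorder_plug, inorder_plug c S']
  exact h.append_right _

theorem minLeaf_plug {c : List (α × BinaryTree α)} {S : BinaryTree α} {x : α}
    (h : minLeaf S = some x) : minLeaf (plug c S) = some x := by
  rw [← head?_inorder, inorder_plug, List.head?_append, head?_inorder, h, Option.some_or]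

theorem rootLabel_plug_ne {c : List (α × BinaryTree α)} {S : BinaryTree α} {a : α}
    (hc : ∀ p ∈ c, p.1 ≠ a) (hS : rootLabel S ≠ some a) : rootLabel (plug c S) ≠ some a := by
  cases c with
  | nil => exact hS
  | cons p c => simpa [plug_cons, rootLabel] using hc p (by simp)

theorem plug_node_inj {c c' : List (α × BinaryTree α)} {a : α} {l l' r r' : BinaryTree α}
    (hc : ∀ p ∈ c, p.1 ≠ a) (hc' : ∀ p ∈ c', p.1 ≠ a)
    (h : plug c (.node a l r) = plug c' (.node a l' r')) : c = c' ∧ l = l' ∧ r = r' := by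
  induction c generalizing c' with
  | nil =>
    cases c' with
    | nil => simpa [plug] using h
    | cons p c' =>
      simp only [plug, List.foldr_nil, List.foldr_cons, BinaryTree.node.injEq] at h
      exact (hc' p (by simp) h.1.symm).elim
  | cons p c ih =>
    cases c' with
    | nil =>
      simp only [plug, List.foldr_nil, List.foldr_cons, BinaryTree.node.injEq] at h
      exact (hc p (by simp) h.1).elim
    | cons p' c' =>
      simp only [plug_cons, BinaryTree.node.injEq] at h
      obtain ⟨rfl, hlr⟩ := ih (fun q hq => hc q (by simp [hq]))
        (fun q hq => hc' q (by simp [hq])) h.2.1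
      exact ⟨by rw [Prod.ext h.1 h.2.2], hlr⟩

theorem isIncreasing_node_leaf_iff [Preorder α] {v a : α} {r : BinaryTree α} :
    IsIncreasing (.node v (leaf a) r) ↔
      v < a ∧ (∀ y ∈ inorder r, a < y) ∧ IsIncreasing r := by
  simp only [isIncreasing_node_iff, inorder, List.nil_append, List.mem_singleton, forall_eq,
    exists_eq_left, List.not_mem_nil, false_imp_iff, implies_true, true_and]
  exact ⟨fun h => ⟨h.1, h.2.2.1, h.2.2.2.2⟩,
    fun h => ⟨h.1, fun y hy => h.1.trans (h.2.1 y hy), h.2.1, ⟨trivial, trivial⟩, h.2.2⟩⟩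

theorem IsIncreasing.of_plug [LT α] {c : List (α × BinaryTree α)} {S : BinaryTree α}
    (h : IsIncreasing (plug c S)) : IsIncreasing S := by
  induction c with
  | nil => exact h
  | cons p c ih => exact ih h.2.2.2.1

theorem IsIncreasing.lt_of_mem_plug [Preorder α] {c : List (α × BinaryTree α)} {S : BinaryTree α}
    (h : IsIncreasing (plug c S)) {p : α × BinaryTree α} (hp : p ∈ c) {x : α}
    (hx : x ∈ inorder S) : p.1 < x := by
  induction c with
  | nil => simp at hp
  | cons q c ih =>
    rw [plug_cons, isIncreasing_node_iff] at h
    rcases List.mem_cons.1 hp with rfl | hp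
    · exact h.1 x (by rw [inorder_plug]; exact List.mem_append_left _ hx)
    · exact ih h.2.2.2.1 hp

theorem IsIncreasing.plug_replace [Preorder α] {c : List (α × BinaryTree α)} {S S' : BinaryTree α}
    (h : IsIncreasing (plug c S)) (hS' : IsIncreasing S')
    (hlt : ∀ p ∈ c, ∀ x ∈ inorder S', p.1 < x) (hle : ∀ y ∈ inorder S, ∃ x ∈ inorder S', x ≤ y) :
    IsIncreasing (plug c S') := by
  induction c with
  | nil => exact hS'
  | cons p c ih =>
    simp only [plug_cons, isIncreasing_node_iff, inorder_plug c S, inorder_plug c S',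
      List.mem_append] at h ⊢
    obtain ⟨hl, hr, hlr, il, ir⟩ := h
    refine ⟨?_, hr, fun y hy => ?_, ih il fun q hq => hlt q (List.mem_cons_of_mem _ hq), ir⟩
    · rintro x (hx | hx)
      exacts [hlt p (by simp) x hx, hl x (.inr hx)]
    · obtain ⟨x, hx | hx, hxy⟩ := hlr y hy
      · obtain ⟨x', hx', hle⟩ := hle x hx
        exact ⟨x', .inl hx', hle.trans_lt hxy⟩
      · exact ⟨x, .inr hx, hxy⟩

theorem IsIncreasing.plug_replace_of_perm [Preorder α] {c : List (α × BinaryTree α)}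
    {S S' : BinaryTree α} (h : IsIncreasing (plug c S)) (hS' : IsIncreasing S')
    (hp : (inorder S').Perm (inorder S)) : IsIncreasing (plug c S') :=
  h.plug_replace hS' (fun _ hq _ hx => h.lt_of_mem_plug hq (hp.mem_iff.1 hx))
    fun y hy => ⟨y, hp.mem_iff.2 hy, le_rfl⟩

/-- The minimal path of the tree ends with the edge from `a` to the leaf `b`. -/
def HasLastEdge (a b : α) (T : BinaryTree α) : Prop :=
  ∃ c r, T = plug c (.node a (leaf b) r)

theorem HasLastEdge.minLeaf_eq {a b : α} {T : BinaryTree α} (h : HasLastEdge a b T) :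
    minLeaf T = some b := by
  obtain ⟨c, r, rfl⟩ := h
  exact minLeaf_plug rfl

theorem minLeaf_node_eq_some {v x : α} {l r : BinaryTree α} :
    minLeaf (.node v l r) = some x ↔ minLeaf l = some x ∨ l = .nil ∧ v = x := by
  cases l <;> simp [minLeaf]

theorem eq_leaf_of_rootLabel_of_minLeaf [Preorder α] {T : BinaryTree α} (hT : IsIncreasing T)
    {a : α} (hr : rootLabel T = some a) (hm : minLeaf T = some a) : T = leaf a := by
  cases T with
  | nil => cases hr
  | node v l r =>
    obtain rfl : v = a := by simpa only [rootLabel, Option.some.injEq] using hr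
    rcases minLeaf_node_eq_some.1 hm with hl | ⟨rfl, -⟩
    · exact ((isIncreasing_node_iff.1 hT).1 v (mem_inorder_of_minLeaf hl)).false.elim
    · cases r with
      | nil => rfl
      | node y l' r' => simpa [rootLabel] using hT.2.2.1 y rfl

theorem not_mem_right_of_minLeaf {v x : α} {l r : BinaryTree α}
    (hn : (inorder (.node v l r)).Nodup) (hx : minLeaf (.node v l r) = some x) :
    x ∉ inorder r := by
  simp only [inorder, List.nodup_append, List.nodup_cons] at hn
  rcases minLeaf_node_eq_some.1 hx with hl | ⟨-, rfl⟩
  · exact fun hr => hn.2.2 x (mem_inorder_of_minLeaf hl) x (by simp [hr]) rfl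
  · exact hn.2.1.1

end LeftSpine

section TreeSurgery

variable {a b : ℕ} {T : BinaryTree ℕ}

theorem graft_plug {k v : ℕ} {c : List (ℕ × BinaryTree ℕ)} {l r : BinaryTree ℕ}
    (hc : ∀ p ∈ c, p.1 ≤ k) (hv : k < v) :
    graft k (plug c (.node v l r)) = plug c (.node (k - 1) (leaf k) (.node v l r)) := by
  induction c with
  | nil => simp [plug, graft, hv]
  | cons p c ih =>
    rw [plug_cons, graft, if_neg (hc p (by simp)).not_gt, ih fun q hq => hc q (by simp [hq]),
      plug_cons]

theorem exists_plug_of_lt_minLeaf {k x : ℕ} (hx : minLeaf T = some x) (hk : k < x) :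
    ∃ c v l r, T = plug c (.node v l r) ∧ (∀ p ∈ c, p.1 ≤ k) ∧ k < v := by
  induction T with
  | nil => cases hx
  | node v l r hl _ =>
    rcases lt_or_ge k v with hv | hv
    · exact ⟨[], v, l, r, rfl, by simp, hv⟩
    · rcases minLeaf_node_eq_some.1 hx with hx | ⟨-, rfl⟩
      · obtain ⟨c, v', l', r', rfl, hc, hv'⟩ := hl hx
        exact ⟨(v, r) :: c, v', l', r', rfl, by simpa [hv] using hc, hv'⟩
      · omega

/-- `T` arises from an increasing tree by inserting `a`, with the leaf `a + 1` as left child, on an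
edge of the minimal path or above the root. These are the values of `graft (a + 1)`. -/
def IsGraft (a : ℕ) (T : BinaryTree ℕ) : Prop :=
  ∃ c S, S ≠ .nil ∧ IsIncreasing (plug c S) ∧ T = plug c (.node a (leaf (a + 1)) S)

theorem IsGraft.hasLastEdge (h : IsGraft a T) : HasLastEdge a (a + 1) T := by
  obtain ⟨c, S, -, -, rfl⟩ := h
  exact ⟨c, S, rfl⟩

theorem IsIncreasing.ne_of_mem_plug {c : List (ℕ × BinaryTree ℕ)} {l r : BinaryTree ℕ}
    (h : IsIncreasing (plug c (.node a l r))) : ∀ p ∈ c, p.1 ≠ a :=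
  fun _ hp => (h.lt_of_mem_plug hp (by simp [inorder])).ne

theorem rotate_plug {v : ℕ} {c : List (ℕ × BinaryTree ℕ)} {A B : BinaryTree ℕ}
    (hc : ∀ p ∈ c, p.1 ≠ a) (hv : v ≠ a) :
    rotate (a + 1) (plug c (.node v (leaf a) (.node (a + 1) A B))) =
      plug c (.node v (.node a (leaf (a + 1)) B) A) := by
  induction c with
  | nil => simp [plug, rotate, rootLabel, BinaryTree.left, BinaryTree.right]
  | cons p c ih =>
    have hc' : ∀ q ∈ c, q.1 ≠ a := fun q hq => hc q (by simp [hq])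
    have hroot : rootLabel (plug c (.node v (leaf a) (.node (a + 1) A B))) ≠ some a :=
      rootLabel_plug_ne hc' (by simpa [rootLabel] using hv)
    rw [plug_cons, rotate, if_neg fun h => hroot h.1, ih hc', plug_cons]

theorem areSiblings_node {v : ℕ} {l r : BinaryTree ℕ} : areSiblings a b (.node v l r) = true ↔
    (rootLabel l = some a ∧ rootLabel r = some b) ∨ areSiblings a b l = true ∨
      areSiblings a b r = true := by
  simp [areSiblings, or_assoc]

theorem areSiblings_plug (c : List (ℕ × BinaryTree ℕ)) (v : ℕ) (A B A' B' : BinaryTree ℕ) :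
    areSiblings a b (plug c (.node v (.node a A' B') (.node b A B))) := by
  induction c with
  | nil => exact areSiblings_node.2 (.inl ⟨rfl, rfl⟩)
  | cons p c ih => exact areSiblings_node.2 (.inr (.inl ih))

theorem mem_inorder_of_areSiblings (h : areSiblings a b T) : a ∈ inorder T ∧ b ∈ inorder T := by
  induction T with
  | nil => simp [areSiblings] at h
  | node v l r hl hr =>
    simp only [inorder, List.mem_append, List.mem_cons]
    rcases areSiblings_node.1 h with h | h | h
    · exact ⟨.inl (mem_inorder_of_rootLabel h.1), .inr (.inr (mem_inorder_of_rootLabel h.2))⟩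
    · exact ⟨.inl (hl h).1, .inl (hl h).2⟩
    · exact ⟨.inr (.inr (hr h).1), .inr (.inr (hr h).2)⟩

theorem exists_plug_of_areSiblings (hT : IsIncreasing T) (hn : (inorder T).Nodup)
    (hm : minLeaf T = some a) (h : areSiblings a b T) :
    ∃ c v A B, T = plug c (.node v (leaf a) (.node b A B)) := by
  induction T with
  | nil => cases hm
  | node v l r hl _ =>
    rcases areSiblings_node.1 h with ⟨hla, hrb⟩ | h | h
    · have hml : minLeaf l = some a := by
        rcases minLeaf_node_eq_some.1 hm with hml | ⟨rfl, -⟩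
        exacts [hml, by cases hla]
      cases r with
      | nil => cases hrb
      | node b' A B =>
        obtain rfl : b' = b := by simpa only [rootLabel, Option.some.injEq] using hrb
        exact ⟨[], v, A, B, by
          rw [eq_leaf_of_rootLabel_of_minLeaf hT.2.2.2.1 hla hml]; rfl⟩
    · have hml : minLeaf l = some a := by
        rcases minLeaf_node_eq_some.1 hm with hml | ⟨rfl, -⟩
        exacts [hml, by simp [areSiblings] at h]
      obtain ⟨c, v', A, B, rfl⟩ := hl hT.2.2.2.1 (List.nodup_append.1 hn).1 hml h
      exact ⟨(v, r) :: c, v', A, B, rfl⟩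
    · exact (not_mem_right_of_minLeaf hn hm (mem_inorder_of_areSiblings h).1).elim

theorem not_areSiblings_of_minLeaf (hn : (inorder T).Nodup) (hm : minLeaf T = some b) :
    ¬ areSiblings a b T := by
  induction T with
  | nil => cases hm
  | node v l r hl _ =>
    intro h
    have hbr := not_mem_right_of_minLeaf hn hm
    rcases areSiblings_node.1 h with h | h | h
    · exact hbr (mem_inorder_of_rootLabel h.2)
    · rcases minLeaf_node_eq_some.1 hm with hml | ⟨rfl, -⟩
      · exact hl (List.nodup_append.1 hn).1 hml h
      · simp [areSiblings] at h
    · exact hbr (mem_inorder_of_areSiblings h).2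

theorem swap_lt_swap {x y : ℕ} (h : x < y) (hxy : ¬ (x = a ∧ y = a + 1)) :
    Equiv.swap a (a + 1) x < Equiv.swap a (a + 1) y := by
  simp only [Equiv.swap_apply_def]
  split_ifs <;> omega

theorem strictMonoOn_swap {s : Set ℕ} (h : a ∉ s ∨ a + 1 ∉ s) :
    StrictMonoOn (Equiv.swap a (a + 1)) s :=
  fun _ hx _ hy hxy => swap_lt_swap hxy fun hxy' =>
    h.elim (fun h => h (hxy'.1 ▸ hx)) fun h => h (hxy'.2 ▸ hy)

theorem IsIncreasing.map_swap {x : ℕ} (hT : IsIncreasing T) (hn : (inorder T).Nodup)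
    (hx : minLeaf T = some x) (hxa : x = a ∨ x = a + 1) (he : ¬ HasLastEdge a (a + 1) T)
    (hs : ¬ areSiblings a (a + 1) T) : IsIncreasing (T.map (Equiv.swap a (a + 1))) := by
  induction T with
  | nil => trivial
  | node v l r hl _ =>
    have hxr : x ∉ inorder r := not_mem_right_of_minLeaf hn hx
    obtain ⟨h1, h2, h3, il, ir⟩ := hT
    have hvl := (isIncreasing_node_iff.1 ⟨h1, h2, h3, il, ir⟩).1
    simp only [BinaryTree.map, IsIncreasing, rootLabel_map, Option.mem_def, Option.map_eq_some_iff,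
      forall_exists_index, and_imp, forall_apply_eq_imp_iff₂]
    refine ⟨fun y hy => swap_lt_swap (h1 y hy) ?_, fun y hy => swap_lt_swap (h2 y hy) ?_,
      fun y hy => ?_, ?_, ?_⟩
    · rintro ⟨rfl, rfl⟩
      rcases minLeaf_node_eq_some.1 hx with hml | ⟨rfl, -⟩
      · have := hvl x (mem_inorder_of_minLeaf hml)
        obtain rfl : x = v + 1 := by omega
        exact he ⟨[], r, by rw [eq_leaf_of_rootLabel_of_minLeaf il hy hml]; rfl⟩
      · cases hy
    · rintro ⟨rfl, rfl⟩
      obtain rfl : x = v := hxa.resolve_right fun h => hxr (h ▸ mem_inorder_of_rootLabel hy)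
      rcases minLeaf_node_eq_some.1 hx with hml | ⟨rfl, -⟩
      · exact (hvl x (mem_inorder_of_minLeaf hml)).false
      · obtain ⟨z, hz, -⟩ := h3 _ hy
        cases hz
    · obtain ⟨z, hz, hzy⟩ := h3 y hy
      exact ⟨_, ⟨z, hz, rfl⟩, swap_lt_swap hzy fun h =>
        hs (areSiblings_node.2 (.inl ⟨h.1 ▸ hz, h.2 ▸ hy⟩))⟩
    · rcases minLeaf_node_eq_some.1 hx with hml | ⟨rfl, -⟩
      · refine hl il (List.nodup_append.1 hn).1 hml (fun ⟨c, r', h⟩ => he ⟨(v, r) :: c, r', ?_⟩)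
          fun h => hs (areSiblings_node.2 (.inr (.inl h)))
        rw [h, plug_cons]
      · trivial
    · exact (isIncreasing_map_iff (strictMonoOn_swap (hxa.imp (· ▸ hxr) (· ▸ hxr)))).2 ir

end TreeSurgery

section RotateOrSwap

theorem perm_range'_iff {n : ℕ} {w : List ℕ} :
    w.Perm (List.range' 1 n) ↔ w.Nodup ∧ ∀ x, x ∈ w ↔ 1 ≤ x ∧ x ≤ n := by
  constructor
  · intro h
    refine ⟨h.nodup_iff.2 List.nodup_range', fun x => ?_⟩
    rw [h.mem_iff, List.mem_range'_1]
    omega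
  · rintro ⟨hn, hmem⟩
    refine (List.perm_ext_iff_of_nodup hn List.nodup_range').2 fun x => ?_
    rw [hmem, List.mem_range'_1]
    omega

theorem perm_map_swap {n i j : ℕ} (hi : i ∈ List.range' 1 n) (hj : j ∈ List.range' 1 n)
    {w : List ℕ} (hw : w.Perm (List.range' 1 n)) :
    (w.map (Equiv.swap i j)).Perm (List.range' 1 n) := by
  refine (hw.map _).trans ((List.perm_ext_iff_of_nodup
    (List.Nodup.map (Equiv.injective _) List.nodup_range') List.nodup_range').2 fun x => ?_)
  rw [← Equiv.swap_apply_self i j x, List.mem_map_of_injective (Equiv.injective _),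
    Equiv.swap_apply_self, Equiv.swap_apply_def]
  split_ifs with h h' <;> simp_all

/-- Increasing 1-2 trees on `[n]` with minimal leaf `k`. -/
def increasingTrees (n k : ℕ) : Set (BinaryTree ℕ) :=
  {T | IsIncreasing T ∧ (inorder T).Perm (List.range' 1 n) ∧ minLeaf T = some k}

/-- The step of `psi` for down-up permutations with first entry `a + 1` and second entry smaller
than `a`. -/
def rotateOrSwap (a : ℕ) (T : BinaryTree ℕ) : BinaryTree ℕ :=
  if areSiblings a (a + 1) T then rotate (a + 1) T else T.map (Equiv.swap a (a + 1))

variable {n a k : ℕ} {T : BinaryTree ℕ}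

theorem nodup_of_mem_increasingTrees (hT : T ∈ increasingTrees n k) : (inorder T).Nodup :=
  (perm_range'_iff.1 hT.2.1).1

theorem map_swap_mem_increasingTrees {x : ℕ} (ha : a ∈ List.range' 1 n)
    (ha' : a + 1 ∈ List.range' 1 n) (hx : x = a ∨ x = a + 1) (hT : T ∈ increasingTrees n x)
    (he : ¬ HasLastEdge a (a + 1) T) (hs : ¬ areSiblings a (a + 1) T) :
    T.map (Equiv.swap a (a + 1)) ∈ increasingTrees n (Equiv.swap a (a + 1) x) :=
  ⟨hT.1.map_swap (nodup_of_mem_increasingTrees hT) hT.2.2 hx he hs,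
    by rw [inorder_map]; exact perm_map_swap ha ha' hT.2.1, by rw [minLeaf_map, hT.2.2]; rfl⟩

theorem map_swap_map_swap (a b : ℕ) (T : BinaryTree ℕ) :
    (T.map (Equiv.swap a b)).map (Equiv.swap a b) = T :=
  map_map_eq_self fun x _ => Equiv.swap_apply_self a b x

theorem not_hasLastEdge_map_swap (hT : IsIncreasing T) :
    ¬ HasLastEdge a (a + 1) (T.map (Equiv.swap a (a + 1))) := by
  rintro ⟨c, r, h⟩
  rw [← map_swap_map_swap a (a + 1) T, h, map_plug] at hT
  simpa [BinaryTree.map] using hT.of_plug.1 _ rfl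

theorem bijOn_map_swap_increasingTrees (ha : a ∈ List.range' 1 n) (ha' : a + 1 ∈ List.range' 1 n) :
    Set.BijOn (BinaryTree.map (Equiv.swap a (a + 1)))
      {T ∈ increasingTrees n a | ¬ areSiblings a (a + 1) T}
      {T ∈ increasingTrees n (a + 1) | ¬ HasLastEdge a (a + 1) T} := by
  refine ⟨?_, (map_injective (Equiv.injective _)).injOn, ?_⟩
  · rintro T ⟨hT, hs⟩
    have he : ¬ HasLastEdge a (a + 1) T := fun h => by simpa [hT.2.2] using h.minLeaf_eq
    exact ⟨by simpa using map_swap_mem_increasingTrees ha ha' (.inl rfl) hT he hs,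
      not_hasLastEdge_map_swap hT.1⟩
  · rintro T ⟨hT, he⟩
    have hs := not_areSiblings_of_minLeaf (a := a) (nodup_of_mem_increasingTrees hT) hT.2.2
    have hT' : T.map (Equiv.swap a (a + 1)) ∈ increasingTrees n a := by
      simpa using map_swap_mem_increasingTrees ha ha' (.inr rfl) hT he hs
    refine ⟨_, ⟨hT', fun h => ?_⟩, map_swap_map_swap a (a + 1) T⟩
    obtain ⟨c, v, A, B, h⟩ :=
      exists_plug_of_areSiblings hT'.1 (nodup_of_mem_increasingTrees hT') hT'.2.2 h
    have hinc := hT.1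
    rw [← map_swap_map_swap a (a + 1) T, h, map_plug] at hinc
    simpa [BinaryTree.map, rootLabel] using hinc.of_plug.2.2.1

section Rotate

variable {c : List (ℕ × BinaryTree ℕ)} {v : ℕ} {A B : BinaryTree ℕ}

theorem perm_inorder_rotate (v x y : ℕ) (A B : BinaryTree ℕ) :
    (inorder (.node v (.node x (leaf y) B) A)).Perm
      (inorder (.node v (leaf x) (.node y A B))) := by
  rw [List.perm_iff_count]
  intro z
  simp only [inorder, List.count_append, List.count_cons, List.count_nil]
  omega

theorem rotated_mem_increasingTrees
    (hT : plug c (.node v (leaf a) (.node (a + 1) A B)) ∈ increasingTrees n a) :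
    plug c (.node v (.node a (leaf (a + 1)) B) A) ∈ increasingTrees n (a + 1) := by
  have hperm := perm_inorder_rotate v a (a + 1) A B
  have hinc : IsIncreasing (.node v (.node a (leaf (a + 1)) B) A) := by
    obtain ⟨hva, -, h⟩ := isIncreasing_node_leaf_iff.1 hT.1.of_plug
    obtain ⟨hA, hB, -, iA, iB⟩ := isIncreasing_node_iff.1 h
    rw [isIncreasing_node_iff, isIncreasing_node_leaf_iff]
    refine ⟨?_, fun y hy => by have := hA y hy; omega,
      fun y hy => ⟨a + 1, by simp [inorder], hA y hy⟩, ⟨by omega, hB, iB⟩, iA⟩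
    simp only [inorder, List.nil_append, List.singleton_append, List.mem_cons, forall_eq_or_imp]
    exact ⟨by omega, hva, fun y hy => by have := hB y hy; omega⟩
  exact ⟨hT.1.plug_replace_of_perm hinc hperm, (perm_inorder_plug hperm c).trans hT.2.1,
    minLeaf_plug rfl⟩

theorem not_isGraft_rotated
    (hT : IsIncreasing (plug c (.node v (.node a (leaf (a + 1)) B) A)))
    (hAB : ∀ y ∈ inorder B, ∃ x ∈ inorder A, x < y) :
    ¬ IsGraft a (plug c (.node v (.node a (leaf (a + 1)) B) A)) := by
  rintro ⟨c', S, hS, hinc, h⟩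
  have hc := IsIncreasing.ne_of_mem_plug
    (c := c ++ [(v, A)]) (a := a) (l := leaf (a + 1)) (r := B) (by rwa [plug_append])
  obtain ⟨rfl, -, rfl⟩ := plug_node_inj (c := c ++ [(v, A)]) hc
    (IsIncreasing.ne_of_mem_plug (h ▸ hT)) (by rwa [plug_append])
  rw [plug_append] at hinc
  obtain ⟨-, -, hBA, iB, -⟩ := isIncreasing_node_iff.1 hinc.of_plug
  cases hb : rootLabel B with
  | none => exact hS (rootLabel_eq_none.1 hb)
  | some b =>
    obtain ⟨x, hx, hxb⟩ := hAB b (mem_inorder_of_rootLabel hb)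
    obtain ⟨y, hy, hyx⟩ := hBA x hx
    exact ((iB.rootLabel_le hb hy).trans_lt (hyx.trans hxb)).false

theorem forall_exists_lt_of_not_isGraft
    (hT : IsIncreasing (plug c (.node v (.node a (leaf (a + 1)) B) A)))
    (hn : (inorder (.node v (.node a (leaf (a + 1)) B) A)).Nodup)
    (hg : ¬ IsGraft a (plug c (.node v (.node a (leaf (a + 1)) B) A))) :
    ∀ y ∈ inorder B, ∃ x ∈ inorder A, x < y := by
  by_contra! h
  obtain ⟨b, hb, hbA⟩ := h
  have hbA' : b ∉ inorder A := fun hb' => by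
    simp only [inorder, List.nodup_append] at hn
    exact hn.2.2 b (by simp [hb]) b (by simp [hb']) rfl
  obtain ⟨hl, hr, -, il, iA⟩ := isIncreasing_node_iff.1 hT.of_plug
  have hinc : IsIncreasing (.node v B A) := isIncreasing_node_iff.2
    ⟨fun x hx => hl x (by simp [inorder, hx]), hr,
      fun y hy => ⟨b, hb, (hbA y hy).lt_of_ne fun h => hbA' (h ▸ hy)⟩, il.2.2.2.2, iA⟩
  have hinc' : IsIncreasing (plug c (.node v B A)) := by
    refine hT.plug_replace hinc (fun p hp x hx => hT.lt_of_mem_plug hp ?_)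
      fun y hy => ⟨v, by simp [inorder], hT.of_plug.rootLabel_le rfl hy⟩
    simp only [inorder, List.mem_append, List.mem_cons] at hx ⊢
    tauto
  exact hg ⟨c ++ [(v, A)], B, fun h => by simp [h, inorder] at hb, by rwa [plug_append],
    by rw [plug_append]; rfl⟩

theorem unrotated_mem_increasingTrees
    (hT : plug c (.node v (.node a (leaf (a + 1)) B) A) ∈ increasingTrees n (a + 1))
    (hg : ¬ IsGraft a (plug c (.node v (.node a (leaf (a + 1)) B) A))) :
    plug c (.node v (leaf a) (.node (a + 1) A B)) ∈ increasingTrees n a := by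
  have hn := nodup_of_plug (nodup_of_mem_increasingTrees hT)
  have hperm := (perm_inorder_rotate v a (a + 1) A B).symm
  have hAB := forall_exists_lt_of_not_isGraft hT.1 hn hg
  have hinc : IsIncreasing (.node v (leaf a) (.node (a + 1) A B)) := by
    obtain ⟨hl, -, hA, il, iA⟩ := isIncreasing_node_iff.1 hT.1.of_plug
    obtain ⟨-, hB, iB⟩ := isIncreasing_node_leaf_iff.1 il
    have haA : a + 1 ∉ inorder A := not_mem_right_of_minLeaf hn rfl
    have hA' : ∀ y ∈ inorder A, a + 1 < y := fun y hy => by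
      obtain ⟨x, hx, hxy⟩ := hA y hy
      have hax := il.rootLabel_le rfl hx
      have hya : y ≠ a + 1 := fun h => haA (h ▸ hy)
      omega
    rw [isIncreasing_node_leaf_iff, isIncreasing_node_iff]
    refine ⟨hl a (by simp [inorder]), fun y hy => ?_, hA', hB, hAB, iA, iB⟩
    simp only [inorder, List.mem_append, List.mem_cons] at hy
    rcases hy with hy | rfl | hy
    exacts [by have := hA' y hy; omega, by omega, by have := hB y hy; omega]
  exact ⟨hT.1.plug_replace_of_perm hinc hperm, (perm_inorder_plug hperm c).trans hT.2.1,
    minLeaf_plug rfl⟩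

end Rotate

theorem exists_rotate_eq (hT : T ∈ increasingTrees n a) (hs : areSiblings a (a + 1) T) :
    ∃ c v A B, T = plug c (.node v (leaf a) (.node (a + 1) A B)) ∧
      rotate (a + 1) T = plug c (.node v (.node a (leaf (a + 1)) B) A) := by
  obtain ⟨c, v, A, B, rfl⟩ :=
    exists_plug_of_areSiblings hT.1 (nodup_of_mem_increasingTrees hT) hT.2.2 hs
  exact ⟨c, v, A, B, rfl, rotate_plug
    (fun _ hp => (hT.1.lt_of_mem_plug hp (by simp [inorder])).ne) (hT.1.of_plug.1 a rfl).ne⟩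

theorem mapsTo_rotate :
    Set.MapsTo (rotate (a + 1)) {T ∈ increasingTrees n a | areSiblings a (a + 1) T}
      {T ∈ {T ∈ increasingTrees n (a + 1) | ¬ IsGraft a T} | HasLastEdge a (a + 1) T} := by
  rintro T ⟨hT, hs⟩
  obtain ⟨c, v, A, B, rfl, h⟩ := exists_rotate_eq hT hs
  have hT' := rotated_mem_increasingTrees hT
  have hAB := (isIncreasing_node_iff.1 hT.1.of_plug.2.2.2.2).2.2.1
  rw [h]
  exact ⟨⟨hT', not_isGraft_rotated hT'.1 hAB⟩, c ++ [(v, A)], B, by rw [plug_append]; rfl⟩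

theorem injOn_rotate :
    Set.InjOn (rotate (a + 1)) {T ∈ increasingTrees n a | areSiblings a (a + 1) T} := by
  rintro T ⟨hT, hs⟩ T' ⟨hT', hs'⟩ he
  obtain ⟨c, v, A, B, rfl, h⟩ := exists_rotate_eq hT hs
  obtain ⟨c', v', A', B', rfl, h'⟩ := exists_rotate_eq hT' hs'
  have hne := IsIncreasing.ne_of_mem_plug (c := c ++ [(v, A)]) (l := leaf (a + 1)) (r := B)
    (by rw [plug_append]; exact (rotated_mem_increasingTrees hT).1)
  have hne' := IsIncreasing.ne_of_mem_plug (c := c' ++ [(v', A')]) (l := leaf (a + 1)) (r := B')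
    (by rw [plug_append]; exact (rotated_mem_increasingTrees hT').1)
  obtain ⟨hc, -, rfl⟩ := plug_node_inj hne hne' (l := leaf (a + 1)) (r := B)
    (l' := leaf (a + 1)) (r' := B') (by
      rw [plug_append, plug_append]
      exact h.symm.trans (he.trans h'))
  obtain ⟨rfl, hvA⟩ := List.append_inj' hc rfl
  cases hvA
  rfl

theorem bijOn_rotate (hn : 3 ≤ n) :
    Set.BijOn (rotate (a + 1)) {T ∈ increasingTrees n a | areSiblings a (a + 1) T}
      {T ∈ {T ∈ increasingTrees n (a + 1) | ¬ IsGraft a T} | HasLastEdge a (a + 1) T} := by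
  refine ⟨mapsTo_rotate, injOn_rotate, ?_⟩
  rintro T ⟨⟨hT, hg⟩, c, B, rfl⟩
  obtain rfl | ⟨c, ⟨v, A⟩, rfl⟩ := List.eq_nil_or_concat' c
  · refine (hg ⟨[], B, ?_, hT.1.2.2.2.2, rfl⟩).elim
    rintro rfl
    have hlen := hT.2.1.length_eq
    simp [plug, inorder] at hlen
    omega
  · rw [plug_append] at hT hg ⊢
    have hT' := unrotated_mem_increasingTrees hT hg
    have hs := areSiblings_plug (a := a) (b := a + 1) c v A B .nil .nil
    refine ⟨_, ⟨hT', hs⟩, rotate_plug ?_ (hT'.1.of_plug.1 a rfl).ne⟩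
    exact fun _ hp => (hT'.1.lt_of_mem_plug hp (by simp [inorder])).ne

theorem bijOn_rotateOrSwap (hn : 3 ≤ n) (ha : a ∈ List.range' 1 n)
    (ha' : a + 1 ∈ List.range' 1 n) :
    Set.BijOn (rotateOrSwap a) (increasingTrees n a)
      {T ∈ increasingTrees n (a + 1) | ¬ IsGraft a T} := by
  refine bijOn_of_sep (p := (areSiblings a (a + 1) ·)) (q := HasLastEdge a (a + 1))
    ((bijOn_rotate hn).congr fun T hT => (if_pos hT.2).symm) ?_
  have ht : {T ∈ {T ∈ increasingTrees n (a + 1) | ¬ IsGraft a T} | ¬ HasLastEdge a (a + 1) T} =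
      {T ∈ increasingTrees n (a + 1) | ¬ HasLastEdge a (a + 1) T} :=
    Set.ext fun T => ⟨fun h => ⟨h.1.1, h.2⟩, fun h => ⟨⟨h.1, fun hg => h.2 hg.hasLastEdge⟩, h.2⟩⟩
  rw [ht]
  exact (bijOn_map_swap_increasingTrees ha ha').congr fun T hT => (if_neg hT.2).symm

end RotateOrSwap

section StandardLabels

/-- The order-preserving bijection from `ℕ` to `ℕ ∖ {a}`. -/
def skip (a x : ℕ) : ℕ := if x < a then x else x + 1

/-- The order-preserving bijection from `ℕ` to `ℕ ∖ {a, a + 1}`, which makes room for these two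
labels in `psi`. -/
def expand (a x : ℕ) : ℕ := if x < a then x else x + 2

variable {m n a k : ℕ}

theorem strictMono_skip (a : ℕ) : StrictMono (skip a) := fun x y h => by
  simp only [skip]
  split_ifs <;> omega

theorem strictMono_expand (a : ℕ) : StrictMono (expand a) := fun x y h => by
  simp only [expand]
  split_ifs <;> omega

theorem range_expand (a : ℕ) : Set.range (expand a) = {x | x ≠ a ∧ x ≠ a + 1} := by
  ext x
  simp only [Set.mem_range, Set.mem_ofPred_eq, expand]
  constructor
  · rintro ⟨y, rfl⟩
    split_ifs <;> omega
  · intro h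
    rcases lt_or_ge x a with hx | hx
    · exact ⟨x, if_pos hx⟩
    · exact ⟨x - 2, by rw [if_neg] <;> omega⟩

theorem lt_or_lt_of_mem_range_expand {x : ℕ} (h : x ∈ Set.range (expand a)) :
    x < a ∨ a + 1 < x := by
  rw [range_expand] at h
  have := h.1
  have := h.2
  omega

theorem succ_lt_expand_iff {j : ℕ} : a + 1 < expand a j ↔ a ≤ j := by
  simp only [expand]
  split_ifs <;> omega

theorem perm_cons_map_skip_iff (h1 : 1 ≤ a) (ha : a ≤ n + 1) {w : List ℕ} :
    (a :: w.map (skip a)).Perm (List.range' 1 (n + 1)) ↔ w.Perm (List.range' 1 n) := by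
  have h : (a :: (List.range' 1 n).map (skip a)).Perm (List.range' 1 (n + 1)) := by
    refine perm_range'_iff.2 ⟨List.nodup_cons.2
      ⟨?_, List.Nodup.map (strictMono_skip a).injective List.nodup_range'⟩, fun x => ?_⟩
    · simp only [List.mem_map, skip]
      rintro ⟨y, -, hy⟩
      split_ifs at hy <;> omega
    · simp only [List.mem_cons, List.mem_map, List.mem_range'_1, skip]
      constructor
      · rintro (rfl | ⟨y, hy, rfl⟩)
        · omega
        · split_ifs <;> omega
      · intro hx
        rcases lt_trichotomy x a with hxa | hxa | hxa
        · exact .inr ⟨x, by omega, if_pos hxa⟩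
        · exact .inl hxa
        · exact .inr ⟨x - 1, by omega, by rw [if_neg] <;> omega⟩
  rw [← h.congr_right, List.perm_cons, List.map_perm_map_iff (strictMono_skip a).injective]

theorem perm_cons_cons_map_expand_iff (h1 : 1 ≤ a) (ha : a ≤ m + 1) {w : List ℕ} :
    ((a + 1) :: a :: w.map (expand a)).Perm (List.range' 1 (m + 2)) ↔
      w.Perm (List.range' 1 m) := by
  have h : (a :: w.map (skip a)).map (skip (a + 1)) = a :: w.map (expand a) := by
    simp only [List.map_cons, List.map_map]
    congr 1
    · simp [skip]
    · refine List.map_congr_left fun x _ => ?_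
      simp only [Function.comp, skip, expand]
      split_ifs <;> omega
  rw [← h, perm_cons_map_skip_iff (by omega) (by omega), perm_cons_map_skip_iff h1 ha]

/-- Down-up permutations of `[n]` with first entry `k`. -/
def downUpPerms (n k : ℕ) : Set (List ℕ) :=
  {w | w.Perm (List.range' 1 n) ∧ IsDownUp w ∧ w.head? = some k}

theorem exists_eq_cons_cons_cons (hn : 3 ≤ n) {w : List ℕ} (hw : w ∈ downUpPerms n k) :
    ∃ j c u, w = k :: j :: c :: u := by
  have hlen := hw.1.length_eq
  rw [List.length_range'] at hlen
  match w, hw.2.2, hlen with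
  | [_], _, h | [_, _], _, h => simp at h; omega
  | x :: j :: c :: u, h, _ =>
    obtain rfl : x = k := by simpa using h
    exact ⟨j, c, u, rfl⟩

theorem prepend_mem_downUpPerms_iff (hm : 1 ≤ m) (h1 : 1 ≤ a) (ha : a ≤ m + 1) {u : List ℕ} :
    (a + 1) :: a :: u.map (expand a) ∈ downUpPerms (m + 2) (a + 1) ↔
      ∃ j, a ≤ j ∧ u ∈ downUpPerms m j := by
  simp only [downUpPerms, Set.mem_ofPred_eq, perm_cons_cons_map_expand_iff h1 ha, List.head?_cons,
    and_true]
  cases u with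
  | nil =>
    simp
    omega
  | cons j u =>
    rw [List.map_cons, IsDownUp, ← List.map_cons,
      isDownUp_map_iff ((strictMono_expand a).strictMonoOn _)]
    have hj : a < expand a j ↔ a ≤ j := by
      simp only [expand]
      split_ifs <;> omega
    simp [hj, and_comm, and_assoc]

theorem prepend_image (hm : 1 ≤ m) (h1 : 1 ≤ a) (ha : a ≤ m + 1) :
    (fun u : List ℕ => (a + 1) :: a :: u.map (expand a)) '' {u | ∃ j, a ≤ j ∧ u ∈ downUpPerms m j} =
      {w ∈ downUpPerms (m + 2) (a + 1) | w[1]? = some a} := by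
  refine Set.Subset.antisymm ?_ ?_
  · rintro _ ⟨u, hu, rfl⟩
    exact ⟨(prepend_mem_downUpPerms_iff hm h1 ha).2 hu, rfl⟩
  · rintro w ⟨hw, hwa⟩
    obtain ⟨j, c, w, rfl⟩ := exists_eq_cons_cons_cons (by omega) hw
    obtain rfl : j = a := by simpa using hwa
    have hn := (perm_range'_iff.1 hw.1).1
    obtain ⟨u, hu⟩ : c :: w ∈ Set.range (List.map (expand j)) := by
      rw [Set.range_list_map]
      intro x hx
      rw [range_expand]
      simp only [List.nodup_cons, List.mem_cons, not_or] at hn hx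
      grind
    rw [← hu] at hw ⊢
    exact ⟨u, (prepend_mem_downUpPerms_iff hm h1 ha).1 hw, rfl⟩

theorem fst_mem_inorder_plug {c : List (ℕ × BinaryTree ℕ)} {S : BinaryTree ℕ}
    {p : ℕ × BinaryTree ℕ} (hp : p ∈ c) : p.1 ∈ inorder (plug c S) := by
  induction c with
  | nil => simp at hp
  | cons q c ih =>
    simp only [plug_cons, inorder, List.mem_append, List.mem_cons]
    rcases List.mem_cons.1 hp with rfl | hp
    · exact .inr (.inl rfl)
    · exact .inl (ih hp)

theorem inorder_plug_node_leaf (c : List (ℕ × BinaryTree ℕ)) (a b : ℕ) (S : BinaryTree ℕ) :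
    inorder (plug c (.node a (leaf b) S)) = b :: a :: inorder (plug c S) := by
  rw [inorder_plug, inorder_plug c S]
  rfl

theorem exists_graft_eq {j : ℕ} {T : BinaryTree ℕ} (hT : IsIncreasing T) (hx : minLeaf T = some j)
    (hj : a ≤ j) :
    ∃ c S, T.map (expand a) = plug c S ∧ S ≠ .nil ∧ IsIncreasing (plug c S) ∧
      IsIncreasing (plug c (.node a (leaf (a + 1)) S)) ∧
      graft (a + 1) (T.map (expand a)) = plug c (.node a (leaf (a + 1)) S) := by
  have hmin : minLeaf (T.map (expand a)) = some (expand a j) := by rw [minLeaf_map, hx]; rfl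
  obtain ⟨c, v, l, r, h, hc, hv⟩ := exists_plug_of_lt_minLeaf hmin (succ_lt_expand_iff.2 hj)
  have hE : IsIncreasing (plug c (.node v l r)) :=
    h ▸ (isIncreasing_map_iff ((strictMono_expand a).strictMonoOn _)).2 hT
  have hca : ∀ p ∈ c, p.1 < a := fun p hp => by
    have hmem : p.1 ∈ inorder (T.map (expand a)) := h ▸ fst_mem_inorder_plug hp
    rw [inorder_map] at hmem
    obtain ⟨y, -, hy⟩ := List.mem_map.1 hmem
    exact (lt_or_lt_of_mem_range_expand ⟨y, hy⟩).resolve_right (hc p hp).not_gt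
  have hS : ∀ x ∈ inorder (.node v l r), a + 1 < x := fun x hx =>
    hv.trans_le (hE.of_plug.rootLabel_le rfl hx)
  refine ⟨c, .node v l r, h, nofun, hE, hE.plug_replace ?_ ?_ ?_, by rw [h, graft_plug hc hv]; rfl⟩
  · exact isIncreasing_node_leaf_iff.2 ⟨a.lt_succ_self, hS, hE.of_plug⟩
  · intro p hp x hx
    rcases List.mem_cons.1 hx with rfl | hx
    · exact (hca p hp).trans a.lt_succ_self
    rcases List.mem_cons.1 hx with rfl | hx
    · exact hca p hp
    · exact hE.lt_of_mem_plug hp hx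
  · exact fun y hy => ⟨y, by simp [inorder] at hy ⊢; tauto, le_rfl⟩

theorem mapsTo_graft (h1 : 1 ≤ a) (ha : a ≤ m + 1) :
    Set.MapsTo (fun T => graft (a + 1) (T.map (expand a)))
      {T | ∃ j, a ≤ j ∧ T ∈ increasingTrees m j}
      {T ∈ increasingTrees (m + 2) (a + 1) | IsGraft a T} := by
  rintro T ⟨j, hj, hT, hp, hx⟩
  obtain ⟨c, S, hcS, hS, hinc, hinc', hg⟩ := exists_graft_eq hT hx hj
  change graft (a + 1) (T.map (expand a)) ∈ _
  rw [hg]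
  refine ⟨⟨hinc', ?_, minLeaf_plug rfl⟩, c, S, hS, hinc, rfl⟩
  rw [inorder_plug_node_leaf, ← hcS, inorder_map]
  exact (perm_cons_cons_map_expand_iff h1 ha).2 hp

theorem injOn_graft : Set.InjOn (fun T => graft (a + 1) (T.map (expand a)))
    {T | ∃ j, a ≤ j ∧ T ∈ increasingTrees m j} := by
  rintro T ⟨j, hj, hT, -, hx⟩ T' ⟨j', hj', hT', -, hx'⟩ h
  obtain ⟨c, S, hcS, -, -, hinc, hg⟩ := exists_graft_eq hT hx hj
  obtain ⟨c', S', hcS', -, -, hinc', hg'⟩ := exists_graft_eq hT' hx' hj'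
  change graft (a + 1) (T.map (expand a)) = graft (a + 1) (T'.map (expand a)) at h
  rw [hg, hg'] at h
  obtain ⟨rfl, -, rfl⟩ := plug_node_inj hinc.ne_of_mem_plug hinc'.ne_of_mem_plug h
  exact map_injective (strictMono_expand a).injective (hcS.trans hcS'.symm)

theorem surjOn_graft (h1 : 1 ≤ a) (ha : a ≤ m + 1) :
    Set.SurjOn (fun T => graft (a + 1) (T.map (expand a)))
      {T | ∃ j, a ≤ j ∧ T ∈ increasingTrees m j}
      {T ∈ increasingTrees (m + 2) (a + 1) | IsGraft a T} := by
  rintro _ ⟨⟨hinc', hp, -⟩, c, S, hS, hinc, rfl⟩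
  rw [inorder_plug_node_leaf] at hp
  have hn := (perm_range'_iff.1 hp).1
  obtain ⟨T, hT⟩ := exists_map_eq (f := expand a) (T := plug c S) fun x hx => by
    rw [range_expand]
    simp only [List.nodup_cons, List.mem_cons, not_or] at hn
    grind
  have hc : ∀ p ∈ c, p.1 < a := fun p hp => hinc'.lt_of_mem_plug hp (by simp [inorder])
  obtain ⟨-, hSa, -⟩ := isIncreasing_node_leaf_iff.1 hinc'.of_plug
  cases S with
  | nil => exact (hS rfl).elim
  | node v l r =>
    have hx : minLeaf (T.map (expand a)) = some ((minLeaf l).getD v) := hT ▸ minLeaf_plug rfl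
    rw [minLeaf_map] at hx
    obtain ⟨j, hj, hjx⟩ := Option.map_eq_some_iff.1 hx
    refine ⟨T, ⟨j, succ_lt_expand_iff.1 ?_, ?_, ?_, hj⟩, ?_⟩
    · rw [hjx]
      exact hSa _ (mem_inorder_of_minLeaf rfl)
    · exact (isIncreasing_map_iff ((strictMono_expand a).strictMonoOn _)).1 (hT ▸ hinc)
    · rwa [← hT, inorder_map, perm_cons_cons_map_expand_iff h1 ha] at hp
    · change graft (a + 1) (T.map (expand a)) = _
      rw [hT, graft_plug (fun p hp => (hc p hp).le.trans a.le_succ)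
        (hSa v (by simp [inorder]))]
      rfl

theorem bijOn_graft (h1 : 1 ≤ a) (ha : a ≤ m + 1) :
    Set.BijOn (fun T => graft (a + 1) (T.map (expand a)))
      {T | ∃ j, a ≤ j ∧ T ∈ increasingTrees m j}
      {T ∈ increasingTrees (m + 2) (a + 1) | IsGraft a T} :=
  ⟨mapsTo_graft h1 ha, injOn_graft, surjOn_graft h1 ha⟩

end StandardLabels

section Psi

variable {m n a k : ℕ}

theorem psi_of_second_eq {u : List ℕ} (hu : u ≠ []) :
    psi ((a + 1) :: a :: u.map (expand a)) = graft (a + 1) ((psi u).map (expand a)) := by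
  have h : (u.map (expand a)).map (fun x => if a + 1 < x then x - 2 else x) = u :=
    list_map_map_eq_self fun x _ => by
      simp only [expand]
      split_ifs <;> omega
  obtain ⟨c, u, rfl⟩ := List.exists_cons_of_ne_nil hu
  rw [List.map_cons] at h ⊢
  rw [psi, if_pos rfl, h]
  congr 2
  funext x
  simp only [expand, Nat.add_lt_add_iff_right]

theorem psi_of_second_lt {j c : ℕ} {u : List ℕ} (h : j < a) :
    psi ((a + 1) :: j :: c :: u) =
      rotateOrSwap a (psi (((a + 1) :: j :: c :: u).map (Equiv.swap a (a + 1)))) := by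
  rw [psi, if_neg (by omega), if_pos (by omega)]
  rfl

theorem map_swap_mem_downUpPerms (hn : 3 ≤ n) (ha : a ∈ List.range' 1 n)
    (ha' : a + 1 ∈ List.range' 1 n) {b b' : ℕ} {w : List ℕ} (hw : w ∈ downUpPerms n b)
    (hb : Equiv.swap a (a + 1) b = b') (hba : b = a ∨ b = a + 1) (hwa : w[1]? ≠ some a) :
    w.map (Equiv.swap a (a + 1)) ∈ {w ∈ downUpPerms n b' | w[1]? ≠ some a} := by
  obtain ⟨j, c, u, rfl⟩ := exists_eq_cons_cons_cons hn hw
  have hja : j ≠ a := by simpa using hwa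
  have hjb : j < b := hw.2.1.1
  have hnb : b ∉ j :: c :: u := (List.nodup_cons.1 (perm_range'_iff.1 hw.1).1).1
  have hj : Equiv.swap a (a + 1) j = j := Equiv.swap_apply_of_ne_of_ne hja (by omega)
  refine ⟨⟨perm_map_swap ha ha' hw.1, hw.2.1.map_cons (strictMonoOn_swap ?_) ?_, by simp [hb]⟩, ?_⟩
  · rcases hba with rfl | rfl
    exacts [.inl hnb, .inr hnb]
  · rw [hj, hb]
    rcases hba with rfl | rfl <;> simp at hb <;> omega
  · simpa [hj] using hja

theorem bijOn_map_swap (hn : 3 ≤ n) (ha : a ∈ List.range' 1 n) (ha' : a + 1 ∈ List.range' 1 n) :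
    Set.BijOn (List.map (Equiv.swap a (a + 1)))
      {w ∈ downUpPerms n (a + 1) | w[1]? ≠ some a} (downUpPerms n a) := by
  have inv : ∀ w : List ℕ, (w.map (Equiv.swap a (a + 1))).map (Equiv.swap a (a + 1)) = w :=
    fun _ => list_map_map_eq_self fun _ _ => Equiv.swap_apply_self _ _ _
  refine Set.InvOn.bijOn ⟨fun w _ => inv w, fun w _ => inv w⟩ (fun w hw => ?_) fun w hw => ?_
  · exact (map_swap_mem_downUpPerms hn ha ha' hw.1 (by simp) (.inr rfl) hw.2).1
  · refine map_swap_mem_downUpPerms hn ha ha' hw (by simp) (.inl rfl) ?_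
    obtain ⟨j, c, u, rfl⟩ := exists_eq_cons_cons_cons hn hw
    simpa using hw.2.1.1.ne

theorem psi_bijOn_union (h : ∀ j, Set.BijOn psi (downUpPerms m j) (increasingTrees m j)) :
    Set.BijOn psi {u | ∃ j, a ≤ j ∧ u ∈ downUpPerms m j}
      {T | ∃ j, a ≤ j ∧ T ∈ increasingTrees m j} := by
  refine ⟨?_, ?_, ?_⟩
  · rintro u ⟨j, hj, hu⟩
    exact ⟨j, hj, (h j).mapsTo hu⟩
  · rintro u ⟨j, -, hu⟩ u' ⟨j', -, hu'⟩ he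
    have hjj' := ((h j).mapsTo hu).2.2
    rw [he, ((h j').mapsTo hu').2.2, Option.some.injEq] at hjj'
    exact (h j').injOn (hjj' ▸ hu) hu' he
  · rintro T ⟨j, hj, hT⟩
    obtain ⟨u, hu, rfl⟩ := (h j).surjOn hT
    exact ⟨u, ⟨j, hj, hu⟩, rfl⟩

theorem psi_bijOn_of_second_eq (hm : 1 ≤ m) (h1 : 1 ≤ a) (ha : a ≤ m + 1)
    (h : ∀ j, Set.BijOn psi (downUpPerms m j) (increasingTrees m j)) :
    Set.BijOn psi {w ∈ downUpPerms (m + 2) (a + 1) | w[1]? = some a}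
      {T ∈ increasingTrees (m + 2) (a + 1) | IsGraft a T} := by
  have hinj : Function.Injective fun u : List ℕ => (a + 1) :: a :: u.map (expand a) :=
    fun u u' he => List.map_injective_iff.2 (strictMono_expand a).injective (by simpa using he)
  rw [← prepend_image hm h1 ha, ← Set.bijOn_comp_iff hinj.injOn]
  refine ((bijOn_graft h1 ha).comp (psi_bijOn_union h)).congr ?_
  rintro u ⟨j, -, hu⟩
  refine (psi_of_second_eq ?_).symm
  rintro rfl
  cases hu.2.2

theorem psi_bijOn_of_second_ne (hn : 3 ≤ n) (ha : a ∈ List.range' 1 n)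
    (ha' : a + 1 ∈ List.range' 1 n)
    (h : Set.BijOn psi (downUpPerms n a) (increasingTrees n a)) :
    Set.BijOn psi {w ∈ downUpPerms n (a + 1) | w[1]? ≠ some a}
      {T ∈ increasingTrees n (a + 1) | ¬ IsGraft a T} := by
  refine ((bijOn_rotateOrSwap hn ha ha').comp (h.comp (bijOn_map_swap hn ha ha'))).congr ?_
  rintro w ⟨hw, hwa⟩
  obtain ⟨j, c, u, rfl⟩ := exists_eq_cons_cons_cons hn hw
  have hja : j ≠ a := by simpa using hwa
  have hj : j < a + 1 := hw.2.1.1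
  exact (psi_of_second_lt (by omega)).symm

theorem psi_bijOn_step (hm : 1 ≤ m) (h1 : 1 ≤ a) (ha : a ≤ m + 1)
    (hm' : ∀ j, Set.BijOn psi (downUpPerms m j) (increasingTrees m j))
    (ha' : Set.BijOn psi (downUpPerms (m + 2) a) (increasingTrees (m + 2) a)) :
    Set.BijOn psi (downUpPerms (m + 2) (a + 1)) (increasingTrees (m + 2) (a + 1)) :=
  bijOn_of_sep (psi_bijOn_of_second_eq hm h1 ha hm')
    (psi_bijOn_of_second_ne (by omega) (List.mem_range'_1.2 (by omega))
      (List.mem_range'_1.2 (by omega)) ha')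

theorem psi_bijOn_empty (h : ∀ w, w ∉ downUpPerms n k) (h' : ∀ T, T ∉ increasingTrees n k) :
    Set.BijOn psi (downUpPerms n k) (increasingTrees n k) := by
  rw [Set.eq_empty_of_forall_notMem h, Set.eq_empty_of_forall_notMem h']
  exact Set.bijOn_empty _

theorem psi_bijOn_of_notMem (hk : k ∉ List.range' 1 n) :
    Set.BijOn psi (downUpPerms n k) (increasingTrees n k) :=
  psi_bijOn_empty (fun _ hw => hk (hw.1.mem_iff.1 (List.mem_of_head? hw.2.2)))
    fun _ hT => hk (hT.2.1.mem_iff.1 (mem_inorder_of_minLeaf hT.2.2))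

theorem notMem_downUpPerms_one (hn : 2 ≤ n) (w : List ℕ) : w ∉ downUpPerms n 1 := by
  rintro ⟨hp, hw, hh⟩
  have hlen := hp.length_eq
  rw [List.length_range'] at hlen
  match w, hw, hh, hp with
  | [_], _, _, _ => simp at hlen; omega
  | x :: j :: u, hw, hh, hp =>
    obtain rfl : x = 1 := by simpa using hh
    have hj : j < 1 := by
      cases u with
      | nil => exact hw
      | cons c u => exact hw.1
    have := (perm_range'_iff.1 hp).2 j |>.1 (by simp)
    omega

theorem notMem_increasingTrees_one (hn : 2 ≤ n) (T : BinaryTree ℕ) : T ∉ increasingTrees n 1 := by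
  rintro ⟨hT, hp, hm⟩
  obtain ⟨r, hr, hr1⟩ := hT.exists_rootLabel_le (mem_inorder_of_minLeaf hm)
  have hr' := (perm_range'_iff.1 hp).2 r |>.1 (mem_inorder_of_rootLabel hr)
  obtain rfl : r = 1 := by omega
  have hlen := hp.length_eq
  rw [eq_leaf_of_rootLabel_of_minLeaf hT hr hm, List.length_range'] at hlen
  simp [inorder] at hlen
  omega

theorem psi_bijOn_of_unique {w : List ℕ} {T : BinaryTree ℕ}
    (h : ∀ w', w'.Perm (List.range' 1 n) ∧ w'.head? = some k ↔ w' = w) (hw : IsDownUp w)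
    (hT : IsIncreasing T) (hTw : inorder T = w) (hpsi : psi w = T) :
    Set.BijOn psi (downUpPerms n k) (increasingTrees n k) := by
  obtain ⟨hp, hk⟩ := (h w).2 rfl
  have hs : downUpPerms n k = {w} := Set.eq_singleton_iff_unique_mem.2
    ⟨⟨hp, hw, hk⟩, fun w' hw' => (h w').1 ⟨hw'.1, hw'.2.2⟩⟩
  have ht : increasingTrees n k = {T} := Set.eq_singleton_iff_unique_mem.2
    ⟨⟨hT, hTw ▸ hp, by rw [← head?_inorder, hTw, hk]⟩, fun T' hT' =>
      hT'.1.eq_of_inorder_eq hT (nodup_of_mem_increasingTrees hT') <| hTw ▸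
        (h _).1 ⟨hT'.2.1, (head?_inorder T').trans hT'.2.2⟩⟩
  rw [hs, ht]
  exact Set.bijOn_singleton.2 hpsi

theorem psi_bijOn_one : Set.BijOn psi (downUpPerms 1 1) (increasingTrees 1 1) := by
  refine psi_bijOn_of_unique (w := [1]) (T := leaf 1) (fun w => ?_) trivial ?_ rfl ?_
  · simp +contextual [List.perm_singleton]
  · simp [IsIncreasing, rootLabel]
  · rw [psi]

theorem psi_bijOn_two : Set.BijOn psi (downUpPerms 2 2) (increasingTrees 2 2) := by
  refine psi_bijOn_of_unique (w := [2, 1]) (T := .node 1 (leaf 2) .nil) (fun w => ?_) ?_ ?_ rfl ?_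
  · have : List.range' 1 2 = [1, 2] := rfl
    rw [this, List.perm_pair]
    grind
  · simp [IsDownUp]
  · simp [IsIncreasing, rootLabel]
  · rw [psi]

theorem psi_bijOn (n k : ℕ) : Set.BijOn psi (downUpPerms n k) (increasingTrees n k) := by
  induction n using Nat.strong_induction_on generalizing k with
  | _ n ihn =>
  induction k with
  | zero => exact psi_bijOn_of_notMem (by simp)
  | succ a iha =>
    by_cases han : n < a + 1
    · exact psi_bijOn_of_notMem (by simp; omega)
    match n, a with
    | 0, _ | 1, _ + 1 | 2, _ + 2 => omega
    | 1, 0 => exact psi_bijOn_one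
    | 2, 1 => exact psi_bijOn_two
    | m + 2, 0 =>
      exact psi_bijOn_empty (notMem_downUpPerms_one (by omega))
        (notMem_increasingTrees_one (by omega))
    | m + 3, a + 1 => exact psi_bijOn_step (by omega) (by omega) (by omega) (ihn _ (by omega)) iha

end Psi

section Relabeling

variable {n : ℕ} {k : ℤ} {V : Finset ℤ}

theorem unrank_eq_getElem {i : ℕ} (hi : i ∈ Set.Icc 1 V.card) :
    unrank V i = (V.sort (· ≤ ·))[i - 1]'(by have := hi.1; have := hi.2; simp; omega) :=
  List.getD_eq_getElem _ _ _

theorem strictMonoOn_unrank (V : Finset ℤ) : StrictMonoOn (unrank V) (Set.Icc 1 V.card) := by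
  intro i hi j hj hij
  rw [unrank_eq_getElem hi, unrank_eq_getElem hj]
  have := hi.1
  exact (Finset.sortedLT_sort V).getElem_lt_getElem_of_lt (by omega)

theorem image_unrank (V : Finset ℤ) : unrank V '' Set.Icc 1 V.card = V := by
  refine Set.Subset.antisymm ?_ fun x hx => ?_
  · rintro _ ⟨i, hi, rfl⟩
    rw [unrank_eq_getElem hi, Finset.mem_coe, ← Finset.mem_sort (· ≤ ·)]
    exact List.getElem_mem _
  · rw [Finset.mem_coe, ← Finset.mem_sort (· ≤ ·)] at hx
    obtain ⟨i, hi, rfl⟩ := List.mem_iff_getElem.1 hx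
    rw [Finset.length_sort] at hi
    have hi' : i + 1 ∈ Set.Icc 1 V.card := ⟨by omega, hi⟩
    exact ⟨i + 1, hi', unrank_eq_getElem hi'⟩

theorem rank_unrank {i : ℕ} (hi : i ∈ Set.Icc 1 V.card) : rank V (unrank V i) = i := by
  have h : V.filter (· ≤ unrank V i) = (Finset.Icc 1 i).image (unrank V) := by
    ext x
    rw [Finset.mem_filter, ← Finset.mem_coe, ← image_unrank, Finset.mem_image]
    constructor
    · rintro ⟨⟨j, hj, rfl⟩, hji⟩
      exact ⟨j, Finset.mem_Icc.2 ⟨hj.1, ((strictMonoOn_unrank V).le_iff_le hj hi).1 hji⟩, rfl⟩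
    · rintro ⟨j, hji, rfl⟩
      obtain ⟨hj, hji⟩ := Finset.mem_Icc.1 hji
      have hj' : j ∈ Set.Icc 1 V.card := ⟨hj, hji.trans hi.2⟩
      exact ⟨⟨j, hj', rfl⟩, ((strictMonoOn_unrank V).le_iff_le hj' hi).2 hji⟩
  rw [rank, h, Finset.card_image_of_injOn, Nat.card_Icc, Nat.add_sub_cancel]
  refine (strictMonoOn_unrank V).injOn.mono fun j hj => ?_
  rw [Finset.coe_Icc] at hj
  exact ⟨hj.1, hj.2.trans hi.2⟩

theorem unrank_rank {x : ℤ} (hx : x ∈ V) : unrank V (rank V x) = x := by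
  obtain ⟨i, hi, rfl⟩ : x ∈ unrank V '' Set.Icc 1 V.card := image_unrank V ▸ hx
  rw [rank_unrank hi]

theorem image_rank (V : Finset ℤ) : rank V '' V = Set.Icc 1 V.card := by
  rw [← image_unrank V, Set.image_image]
  exact (Set.image_congr fun i hi => rank_unrank hi).trans (Set.image_id' _)

theorem strictMonoOn_rank (V : Finset ℤ) : StrictMonoOn (rank V) V := by
  rw [← image_unrank V]
  rintro _ ⟨i, hi, rfl⟩ _ ⟨j, hj, rfl⟩ hij
  rwa [rank_unrank hi, rank_unrank hj, ← (strictMonoOn_unrank V).lt_iff_lt hi hj]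

theorem IsSignedPerm.nodup {w : List ℤ} (hw : IsSignedPerm n w) : w.Nodup :=
  List.Nodup.of_map _ (hw.nodup_iff.2 List.nodup_range')

theorem IsSignedPerm.length_eq {w : List ℤ} (hw : IsSignedPerm n w) : w.length = n := by
  simpa using List.Perm.length_eq hw

theorem IsSignedPerm.of_perm {w w' : List ℤ} (hw : IsSignedPerm n w) (h : w'.Perm w) :
    IsSignedPerm n w' :=
  (h.map _).trans hw

theorem IsSignedPerm.card_toFinset {w : List ℤ} (hw : IsSignedPerm n w) : w.toFinset.card = n :=
  (List.toFinset_card_of_nodup hw.nodup).trans hw.length_eq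

theorem IsSignedPerm.map_rank_perm {w : List ℤ} (hw : IsSignedPerm n w) :
    (w.map (rank w.toFinset)).Perm (List.range' 1 n) := by
  refine perm_range'_iff.2 ⟨hw.nodup.map_on fun x hx y hy h =>
    (strictMonoOn_rank w.toFinset).injOn (by simpa using hx) (by simpa using hy) h, fun i => ?_⟩
  have h := Set.ext_iff.1 (image_rank w.toFinset) i
  rw [hw.card_toFinset] at h
  simpa using h

theorem IsSignedPerm.map_unrank_perm {w : List ℤ} (hw : IsSignedPerm n w) {u : List ℕ}
    (hu : u.Perm (List.range' 1 n)) : (u.map (unrank w.toFinset)).Perm w := by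
  refine ((hu.trans hw.map_rank_perm.symm).map _).trans (.of_eq ?_)
  exact list_map_map_eq_self fun x hx => unrank_rank (by simpa using hx)

theorem mem_Icc_card_of_perm {u : List ℕ} (hu : u.Perm (List.range' 1 V.card)) {i : ℕ}
    (hi : i ∈ u) : i ∈ Set.Icc 1 V.card :=
  ((perm_range'_iff.1 hu).2 i).1 hi

theorem bijOn_map_rank_snakesB {v : List ℤ} (hv : IsSignedPerm n v) (hk : k ∈ v) :
    Set.BijOn (List.map (rank v.toFinset)) {w ∈ snakesB n k | w.toFinset = v.toFinset}
      (downUpPerms n (rank v.toFinset k)) := by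
  have hcard := hv.card_toFinset
  set V := v.toFinset
  refine Set.InvOn.bijOn (f' := List.map (unrank V)) ⟨fun w hw => ?_, fun u hu => ?_⟩ ?_ ?_
  · exact list_map_map_eq_self fun x hx => unrank_rank (hw.2 ▸ List.mem_toFinset.2 hx)
  · exact list_map_map_eq_self fun i hi => rank_unrank (mem_Icc_card_of_perm (hcard ▸ hu.1) hi)
  · rintro w ⟨⟨hp, hw, hh⟩, hwV⟩
    refine ⟨hwV ▸ hp.map_rank_perm, ?_, by rw [List.head?_map, hh]; rfl⟩
    exact (isDownUp_map_iff ((strictMonoOn_rank V).mono fun x hx =>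
      hwV ▸ List.mem_toFinset.2 hx)).2 hw
  · rintro u ⟨hp, hu, hh⟩
    have hperm := hv.map_unrank_perm hp
    refine ⟨⟨hv.of_perm hperm, ?_, ?_⟩, List.toFinset_eq_of_perm _ _ hperm⟩
    · exact (isDownUp_map_iff ((strictMonoOn_unrank V).mono fun i hi =>
        mem_Icc_card_of_perm (hcard ▸ hp) hi)).2 hu
    · rw [List.head?_map, hh, Option.map_some, unrank_rank (List.mem_toFinset.2 hk)]

theorem bijOn_map_unrank_treesB {v : List ℤ} (hv : IsSignedPerm n v) (hk : k ∈ v) :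
    Set.BijOn (BinaryTree.map (unrank v.toFinset)) (increasingTrees n (rank v.toFinset k))
      {T ∈ treesB n k | (inorder T).toFinset = v.toFinset} := by
  have hcard := hv.card_toFinset
  set V := v.toFinset
  refine Set.InvOn.bijOn (f' := BinaryTree.map (rank V)) ⟨fun T hT => ?_, fun T hT => ?_⟩ ?_ ?_
  · exact map_map_eq_self fun i hi => rank_unrank (mem_Icc_card_of_perm (hcard ▸ hT.2.1) hi)
  · exact map_map_eq_self fun x hx => unrank_rank (hT.2 ▸ List.mem_toFinset.2 hx)
  · rintro T ⟨hT, hp, hm⟩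
    have hperm := hv.map_unrank_perm hp
    rw [← inorder_map] at hperm
    refine ⟨⟨?_, hv.of_perm hperm, ?_⟩, List.toFinset_eq_of_perm _ _ hperm⟩
    · exact (isIncreasing_map_iff ((strictMonoOn_unrank V).mono fun i hi =>
        mem_Icc_card_of_perm (hcard ▸ hp) hi)).2 hT
    · rw [minLeaf_map, hm, Option.map_some, unrank_rank (List.mem_toFinset.2 hk)]
  · rintro T ⟨⟨hT, hp, hm⟩, hTV⟩
    refine ⟨?_, by rw [inorder_map, ← hTV]; exact hp.map_rank_perm, by rw [minLeaf_map, hm]; rfl⟩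
    exact (isIncreasing_map_iff ((strictMonoOn_rank V).mono fun x hx =>
      hTV ▸ List.mem_toFinset.2 hx)).2 hT

theorem psiB_bijOn (n : ℕ) (k : ℤ) : Set.BijOn psiB (snakesB n k) (treesB n k) := by
  refine bijOn_of_fibers (p := List.toFinset) (q := fun T => (inorder T).toFinset) fun V => ?_
  by_cases h : ∃ v, IsSignedPerm n v ∧ k ∈ v ∧ v.toFinset = V
  · obtain ⟨v, hv, hk, rfl⟩ := h
    refine ((bijOn_map_unrank_treesB hv hk).comp
      ((psi_bijOn n _).comp (bijOn_map_rank_snakesB hv hk))).congr fun w hw => ?_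
    rw [psiB, hw.2]
    rfl
  · have hs : {w ∈ snakesB n k | w.toFinset = V} = ∅ := Set.eq_empty_of_forall_notMem
      fun w hw => h ⟨w, hw.1.1, List.mem_of_head? hw.1.2.2, hw.2⟩
    have ht : {T ∈ treesB n k | (inorder T).toFinset = V} = ∅ := Set.eq_empty_of_forall_notMem
      fun T hT => h ⟨inorder T, hT.1.2.1, mem_inorder_of_minLeaf hT.1.2.2, hT.2⟩
    rw [hs, ht]
    exact Set.bijOn_empty _

theorem omegaB_eq_reverse_inorder (T : BinaryTree ℤ) : omegaB T = (inorder T).reverse := by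
  rw [omegaB, omega, inorder_map, ← List.map_reverse]
  exact list_map_map_eq_self fun x hx => unrank_rank (by simpa using hx)

theorem omegaB_bijOn (n : ℕ) (k : ℤ) : Set.BijOn omegaB (treesB n k) (andreB n k) := by
  refine ⟨?_, ?_, ?_⟩
  · rintro T ⟨hT, hp, hm⟩
    rw [omegaB_eq_reverse_inorder]
    have hp' := hp.of_perm (List.reverse_perm (inorder T))
    refine ⟨hp', ?_, by rw [List.getLast?_reverse, head?_inorder, hm]⟩
    rw [← hp'.length_eq]
    exact (isAndre_iff_smallest _).1 (hT.isAndre hp.nodup)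
  · intro T hT T' hT' h
    rw [omegaB_eq_reverse_inorder, omegaB_eq_reverse_inorder, List.reverse_inj] at h
    exact hT.1.eq_of_inorder_eq hT'.1 hT.2.1.nodup h
  · rintro w ⟨hp, hw, hl⟩
    rw [← hp.length_eq] at hw
    obtain ⟨T, hT, rfl⟩ := ((isAndre_iff_smallest w).2 hw).exists_tree hp.nodup
    refine ⟨T, ⟨hT, hp.of_perm (List.reverse_perm _).symm, ?_⟩, omegaB_eq_reverse_inorder T⟩
    rw [← head?_inorder, ← List.getLast?_reverse, hl]

end Relabeling

section Counting

/-- The odd map on `ℤ` that exchanges `k` with `j` and `-k` with `-j`. -/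
def signedSwap (k j x : ℤ) : ℤ :=
  if x = k then j else if x = j then k else if x = -k then -j else if x = -j then -k else x

/-- The order-preserving bijection from `ℤ` to `ℤ ∖ {k, -k}`, for `k ≠ 0`; an odd map. -/
def signedSkip (k x : ℤ) : ℤ := if |k| ≤ x then x + 1 else if x ≤ -|k| then x - 1 else x

variable {n : ℕ} {k j : ℤ}

theorem natAbs_signedSwap (k j x : ℤ) :
    (signedSwap k j x).natAbs = Equiv.swap k.natAbs j.natAbs x.natAbs := by
  simp only [signedSwap, Equiv.swap_apply_def]
  split_ifs <;> omega

theorem signedSwap_signedSwap (hk : k ≠ 0) (hj : j ≠ 0) (x : ℤ) :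
    signedSwap k j (signedSwap k j x) = x := by
  grind [signedSwap]

theorem strictMonoOn_signedSwap (hk : k ≠ 0) (hj : j ≠ 0) (hjk : j = k - 1 ∨ k = 1 ∧ j = -1)
    {b : ℤ} (hb : b = k ∨ b = j) :
    StrictMonoOn (signedSwap k j) {x | x ≠ 0 ∧ x.natAbs ≠ b.natAbs} := by
  intro x hx y hy hxy
  simp only [Set.mem_ofPred_eq, ne_eq, Int.natAbs_eq_natAbs_iff, not_or] at hx hy
  simp only [signedSwap]
  rcases hjk with rfl | ⟨rfl, rfl⟩ <;> rcases hb with rfl | rfl <;> split_ifs <;> omega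

theorem natAbs_signedSkip (k x : ℤ) : (signedSkip k x).natAbs = skip k.natAbs x.natAbs := by
  simp only [signedSkip, skip, Int.abs_eq_natAbs]
  split_ifs <;> omega

theorem strictMono_signedSkip (k : ℤ) : StrictMono (signedSkip k) := fun x y h => by
  simp only [signedSkip, Int.abs_eq_natAbs]
  split_ifs <;> omega

theorem exists_signedSkip_eq (hk : k ≠ 0) {x : ℤ} (h : x.natAbs ≠ k.natAbs) :
    ∃ y, signedSkip k y = x := by
  simp only [signedSkip, Int.abs_eq_natAbs]
  rcases lt_or_ge (k.natAbs : ℤ) x with hx | hx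
  · exact ⟨x - 1, by rw [if_pos] <;> omega⟩
  rcases lt_or_ge x (-(k.natAbs : ℤ)) with hx' | hx'
  · exact ⟨x + 1, by rw [if_neg, if_pos] <;> omega⟩
  · exact ⟨x, by rw [if_neg, if_neg] <;> omega⟩

theorem IsSignedPerm.natAbs_mem {w : List ℤ} (hw : IsSignedPerm n w) {x : ℤ} (hx : x ∈ w) :
    x.natAbs ∈ List.range' 1 n :=
  hw.mem_iff.1 (List.mem_map_of_mem hx)

theorem isDownUp_cons_cons (a b : ℤ) : ∀ w : List ℤ,
    IsDownUp (a :: b :: w) ↔ b < a ∧ IsDownUp ((b :: w).map Neg.neg)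
  | [] => by simp [IsDownUp]
  | c :: w => by
    have h := isDownUp_cons_cons (-b) (-c) (w.map Neg.neg)
    rw [← List.map_cons, list_map_map_eq_self fun x _ => neg_neg x, neg_lt_neg_iff] at h
    rw [IsDownUp, ← h]
    rfl
termination_by w => w.length

theorem exists_eq_cons_cons (hn : 2 ≤ n) {w : List ℤ} (hw : w ∈ snakesB n k) :
    ∃ i u, w = k :: i :: u ∧ i < k ∧ ∀ x ∈ i :: u, x ≠ 0 ∧ x.natAbs ≠ k.natAbs := by
  obtain ⟨hp, hdu, hh⟩ := hw
  have hlen := hp.length_eq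
  match w, hh, hlen with
  | [_], _, hlen => simp at hlen; omega
  | x :: i :: u, hh, _ =>
    obtain rfl : x = k := by simpa using hh
    have hnodup := hp.nodup_iff.2 List.nodup_range'
    rw [List.map_cons, List.nodup_cons] at hnodup
    refine ⟨i, u, rfl, ((isDownUp_cons_cons _ _ _).1 hdu).1, fun y hy => ⟨?_, fun h => ?_⟩⟩
    · rintro rfl
      simpa using hp.natAbs_mem (List.mem_cons_of_mem x hy)
    · exact hnodup.1 (h ▸ List.mem_map_of_mem hy)

theorem ne_zero_of_natAbs_mem_range' (hk : k.natAbs ∈ List.range' 1 n) : k ≠ 0 :=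
  Int.natAbs_ne_zero.1 (Nat.one_le_iff_ne_zero.1 (List.mem_range'_1.1 hk).1)

theorem map_signedSwap_mem_snakesB (hn : 2 ≤ n) (hk : k.natAbs ∈ List.range' 1 n)
    (hj : j.natAbs ∈ List.range' 1 n) (hjk : j = k - 1 ∨ k = 1 ∧ j = -1) {b : ℤ}
    (hb : b = k ∨ b = j) {w : List ℤ} (hw : w ∈ snakesB n b) (hwj : w[1]? ≠ some j) :
    w.map (signedSwap k j) ∈ {w ∈ snakesB n (signedSwap k j b) | w[1]? ≠ some j} := by
  obtain ⟨i, u, rfl, hib, hne⟩ := exists_eq_cons_cons hn hw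
  have hij : i ≠ j := by simpa using hwj
  have hk0 := ne_zero_of_natAbs_mem_range' hk
  have hj0 := ne_zero_of_natAbs_mem_range' hj
  have himage : signedSwap k j i < signedSwap k j b ∧ signedSwap k j i ≠ j := by
    obtain ⟨hi0, hi⟩ := hne i List.mem_cons_self
    rw [ne_eq, Int.natAbs_eq_natAbs_iff, not_or] at hi
    simp only [signedSwap]
    rcases hjk with rfl | ⟨rfl, rfl⟩ <;> rcases hb with rfl | rfl <;> split_ifs <;> omega
  refine ⟨⟨?_, ?_, rfl⟩, by simpa using himage.2⟩
  · refine .trans (.of_eq ?_) (perm_map_swap hk hj hw.1)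
    rw [List.map_map, List.map_map]
    exact List.map_congr_left fun x _ => natAbs_signedSwap k j x
  · exact hw.2.1.map_cons ((strictMonoOn_signedSwap hk0 hj0 hjk hb).mono hne) himage.1

theorem bijOn_map_signedSwap (hn : 2 ≤ n) (hk : k.natAbs ∈ List.range' 1 n)
    (hj : j.natAbs ∈ List.range' 1 n) (hjk : j = k - 1 ∨ k = 1 ∧ j = -1) :
    Set.BijOn (List.map (signedSwap k j)) {w ∈ snakesB n k | w[1]? ≠ some j} (snakesB n j) := by
  have hkj : signedSwap k j k = j := if_pos rfl
  have hjk' : signedSwap k j j = k := by grind [signedSwap]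
  have inv : ∀ w : List ℤ, (w.map (signedSwap k j)).map (signedSwap k j) = w := fun _ =>
    list_map_map_eq_self fun x _ => signedSwap_signedSwap (ne_zero_of_natAbs_mem_range' hk)
      (ne_zero_of_natAbs_mem_range' hj) x
  refine Set.InvOn.bijOn ⟨fun w _ => inv w, fun w _ => inv w⟩ (fun w hw => ?_) fun w hw => ?_
  · simpa only [hkj] using (map_signedSwap_mem_snakesB hn hk hj hjk (.inl rfl) hw.1 hw.2).1
  · obtain ⟨i, u, rfl, hij, -⟩ := exists_eq_cons_cons hn hw
    simpa only [hjk'] using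
      map_signedSwap_mem_snakesB hn hk hj hjk (.inr rfl) hw (by simpa using hij.ne)

theorem cons_map_signedSkip_mem_snakesB_iff (hk : k.natAbs ∈ List.range' 1 (n + 1)) (hjk : j < k)
    {i : ℤ} (hi : -signedSkip k i = j) {u : List ℤ} :
    k :: u.map (fun x => -signedSkip k x) ∈
      {w ∈ snakesB (n + 1) k | w[1]? = some j} ↔ u ∈ snakesB n i := by
  have hinj : Function.Injective fun x => -signedSkip k x :=
    neg_injective.comp (strictMono_signedSkip k).injective
  have hperm : IsSignedPerm (n + 1) (k :: u.map fun x => -signedSkip k x) ↔ IsSignedPerm n u := by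
    obtain ⟨h1, h2⟩ := List.mem_range'_1.1 hk
    rw [IsSignedPerm, IsSignedPerm,
      ← perm_cons_map_skip_iff h1 (by omega) (w := u.map Int.natAbs), List.map_cons,
      List.map_map, List.map_map]
    simp only [Function.comp_def, Int.natAbs_neg, natAbs_signedSkip]
  cases u with
  | nil => simp [snakesB]
  | cons b u =>
    have hdu : IsDownUp (k :: (b :: u).map fun x => -signedSkip k x) ↔
        -signedSkip k b < k ∧ IsDownUp (b :: u) := by
      rw [List.map_cons, isDownUp_cons_cons,
        ← isDownUp_map_iff (w := b :: u) ((strictMono_signedSkip k).strictMonoOn _)]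
      simp only [List.map_cons, List.map_map, Function.comp_def, neg_neg]
    have hb : -signedSkip k b = j ↔ b = i := by rw [← hi, hinj.eq_iff]
    simp only [snakesB, Set.mem_ofPred_eq, hperm, hdu, List.head?_cons,
      List.getElem?_cons_succ, List.getElem?_map, List.getElem?_cons_zero, Option.map_some,
      Option.some.injEq, hb]
    grind

theorem image_cons_map_signedSkip (hn : 1 ≤ n) (hk : k.natAbs ∈ List.range' 1 (n + 1))
    (hjk : j < k) {i : ℤ} (hi : -signedSkip k i = j) :
    (fun u : List ℤ => k :: u.map fun x => -signedSkip k x) '' snakesB n i =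
      {w ∈ snakesB (n + 1) k | w[1]? = some j} := by
  refine Set.Subset.antisymm ?_ fun w hw => ?_
  · rintro _ ⟨u, hu, rfl⟩
    exact (cons_map_signedSkip_mem_snakesB_iff hk hjk hi).2 hu
  · obtain ⟨c, v, rfl, -, hne⟩ := exists_eq_cons_cons (by omega) hw.1
    obtain ⟨u, hu⟩ : c :: v ∈ Set.range (List.map fun x => -signedSkip k x) := by
      rw [Set.range_list_map]
      intro x hx
      obtain ⟨y, hy⟩ := exists_signedSkip_eq (ne_zero_of_natAbs_mem_range' hk) (x := -x)
        (by simpa using (hne x hx).2)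
      exact ⟨y, by change -signedSkip k y = x; rw [hy, neg_neg]⟩
    rw [← hu] at hw ⊢
    exact ⟨u, (cons_map_signedSkip_mem_snakesB_iff hk hjk hi).1 hw, rfl⟩

theorem encard_snakesB_eq_add (hn : 2 ≤ n) (hk : k.natAbs ∈ List.range' 1 n)
    (hj : j.natAbs ∈ List.range' 1 n) (hjk : j = k - 1 ∨ k = 1 ∧ j = -1) :
    (snakesB n k).encard =
      (snakesB n j).encard + {w ∈ snakesB n k | w[1]? = some j}.encard := by
  rw [← encard_eq_of_bijOn (bijOn_map_signedSwap hn hk hj hjk), ← Set.encard_union_eq]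
  · congr 1
    ext w
    simp only [Set.mem_union, Set.mem_ofPred_eq]
    tauto
  · exact Set.disjoint_left.2 fun w hw hw' => hw.2 hw'.2

theorem encard_snakesB_of_pred (hn : 1 ≤ n) (hk : k.natAbs ∈ List.range' 1 (n + 1))
    (hk' : (k - 1).natAbs ∈ List.range' 1 (n + 1)) {i : ℤ} (hi : -signedSkip k i = k - 1) :
    (snakesB (n + 1) k).encard = (snakesB (n + 1) (k - 1)).encard + (snakesB n i).encard := by
  have hinj : Function.Injective fun u : List ℤ => k :: u.map fun x => -signedSkip k x :=
    List.cons_injective.comp (List.map_injective_iff.2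
      (neg_injective.comp (strictMono_signedSkip k).injective))
  rw [encard_snakesB_eq_add (by omega) hk hk' (.inl rfl),
    ← image_cons_map_signedSkip hn hk (by omega) hi, hinj.encard_image]

theorem encard_snakesB_pos_one (hn : 2 ≤ n) : (snakesB n 1).encard = (snakesB n (-1)).encard := by
  have h : {w ∈ snakesB n 1 | w[1]? = some (-1)} = ∅ := by
    refine Set.eq_empty_of_forall_notMem fun w hw => ?_
    obtain ⟨i, u, rfl, -, hne⟩ := exists_eq_cons_cons hn hw.1
    obtain rfl : i = -1 := by simpa using hw.2
    exact (hne _ List.mem_cons_self).2 rfl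
  rw [encard_snakesB_eq_add hn (by simp; omega) (by simp; omega) (.inr ⟨rfl, rfl⟩), h,
    Set.encard_empty, add_zero]

theorem encard_snakesB_one (hk : k.natAbs = 1) : (snakesB 1 k).encard = 1 := by
  rw [Set.encard_eq_one]
  refine ⟨[k], Set.eq_singleton_iff_unique_mem.2 ⟨⟨?_, trivial, rfl⟩, fun w hw => ?_⟩⟩
  · simp [IsSignedPerm, hk]
  · obtain ⟨a, rfl⟩ := List.length_eq_one_iff.1 hw.1.length_eq
    simpa using hw.2.2

theorem snakesB_neg_eq_empty (hn : 2 ≤ n) : snakesB n (-(n : ℤ)) = ∅ := by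
  refine Set.eq_empty_of_forall_notMem fun w hw => ?_
  obtain ⟨i, u, rfl, hi, -⟩ := exists_eq_cons_cons hn hw
  have := List.mem_range'_1.1 (hw.1.natAbs_mem (x := i) (by simp))
  omega

theorem encard_snakesB (n : ℕ) (k : ℤ) (h1 : 1 ≤ |k|) (hk : |k| ≤ n) :
    (snakesB n k).encard = arnold n k := by
  have mem : ∀ {n : ℕ} {x : ℤ}, 1 ≤ |x| → |x| ≤ n → x.natAbs ∈ List.range' 1 n := fun h h' => by
    rw [Int.abs_eq_natAbs] at h h'
    exact List.mem_range'_1.2 (by omega)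
  fun_induction arnold n k
  case case1 h => exact absurd h (by grind)
  case case2 => exact encard_snakesB_one (by grind)
  case case3 =>
    rw [snakesB_neg_eq_empty (by grind), Set.encard_empty]
    rfl
  case case4 n k h hn hkn hneg ihk ihn =>
    obtain ⟨m, rfl⟩ : ∃ m, n = m + 1 := ⟨n - 1, by grind⟩
    rw [Nat.add_sub_cancel] at ihn ⊢
    rw [encard_snakesB_of_pred (i := -k) (by grind) (mem h1 hk) (mem (by grind) (by grind)),
      ihk (by grind) (by grind), ihn (by grind) (by grind)]
    · exact (Nat.cast_add _ _).symm
    · grind [signedSkip]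
  case case5 n _ hn _ _ ihk =>
    rw [encard_snakesB_pos_one (by grind), ihk (by grind) (by grind)]
  case case6 n k h hn hkn hneg hone ihk ihn =>
    obtain ⟨m, rfl⟩ : ∃ m, n = m + 1 := ⟨n - 1, by grind⟩
    rw [Nat.add_sub_cancel] at ihn ⊢
    rw [encard_snakesB_of_pred (i := -k + 1) (by grind) (mem h1 hk) (mem (by grind) (by grind)),
      ihk (by grind) (by grind), ihn (by grind) (by grind)]
    · exact (Nat.cast_add _ _).symm
    · grind [signedSkip]

end Counting

end ArnoldFamily

theorem theorem2p6 :
    (∀ (n : ℕ) (k : ℤ), 1 ≤ |k| → |k| ≤ (n : ℤ) →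
      Set.BijOn psiB (snakesB n k) (treesB n k) ∧
      Set.BijOn omegaB (treesB n k) (andreB n k) ∧
      (arnold n k : ℕ∞) = (andreB n k).encard ∧
      (andreB n k).encard = (treesB n k).encard) ∧
    IsArnoldFamily andreB ∧ IsArnoldFamily treesB := by
  have trees : IsArnoldFamily treesB := fun n k h1 h2 => by
    rw [← encard_eq_of_bijOn (psiB_bijOn n k), encard_snakesB n k h1 h2]
  have same : ∀ n k, (andreB n k).encard = (treesB n k).encard := fun n k =>
    (encard_eq_of_bijOn (omegaB_bijOn n k)).symm
  have andre : IsArnoldFamily andreB := fun n k h1 h2 => (same n k).trans (trees n k h1 h2)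
  exact ⟨fun n k h1 h2 => ⟨psiB_bijOn n k, omegaB_bijOn n k, (andre n k h1 h2).symm, same n k⟩,
    andre, trees⟩
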